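/- **Proposition (Necessity of ambiguity).** No optimistic twisted SQFT exists, and no sanguine twisted SQFT exists. *Background.* An occupied surface $(\Sigma,V)$ is a compact oriented surface $\Sigma$, possibly disconnected or empty, with a finite set $V=V_+\sqcup V_-\subset\partial\Sigma$ of signed vertices, such that each component of $\Sigma$ has nonempty boundary, each component of $\partial\Sigma$ contains vertices, and signs alternate along each boundary component. The arcs of $\partial\Sigma$ between consecutive vertices are its boundary edges. A vacuum is a disc with two vertices; a square is a disc with four. A set of sutures $\Gamma$ on $(\Sigma,V)$ is a properly embedded $1$-manifold, meeting each boundary edge in exactly one point, with $\Sigma\setminus\Gamma=R_+\sqcup R_-$, where $V_\pm\subset R_\pm$ and each component of $\Gamma$ has $R_+$ on one side and $R_-$ on the other; its Euler class is $e(\Gamma)=\chi(R_+)-\chi(R_-)$. On a square, the basic sutures $\Gamma_+$ (resp. $\Gamma_-$) are two arcs, each cutting off a disc containing a single positive (resp. negative) vertex. A morphism $\phi:(\Sigma,V)\to(\Sigma',V')$ is a continuous map $\Sigma\to\Sigma'$ that embeds the interior of $\Sigma$ preserving orientation and embeds each boundary edge; the images of boundary edges of $\Sigma$ and the boundary edges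 of $\Sigma'$ pairwise coincide or meet only at endpoints; and signs of vertices are respected. A decorated morphism $(\phi,\Gamma_c)$ is a morphism with a set of sutures $\Gamma_c$ on the complement of its image, which is an occupied surface. Decorated morphisms compose, and they send sutures $\Gamma$ on $(\Sigma,V)$ to sutures $\Gamma\cup\Gamma_c$ on $(\Sigma',V')$; occupied surfaces and decorated morphisms form a category. Decorated isotopy is the equivalence relation generated by continuous families of decorated morphisms and by the removal or creation of a vacuum (bounded by two edges and containing one suture arc) in the complement. A quadrangulation of $(\Sigma,V)$ is a decomposition of its non-vacuum components into squares $(\Sigma_i^\square,V_i^\square)$ with vertices in $V$, glued along edges (vacuum components carry the null quadrangulation, with no square). Sutures $\Gamma$ are basic for it if they restrict to basic sutures $\Gamma_i\in\{\Gamma_+,\Gamma_-\}$ on every square and to a single arc on each vacuum component. *Definition.* An **optimistic twisted SQFT** is a pair $(\mathcal D,c)$ as follows. $\mathcal D$ is a functor that assigns to each occupied surface a $\mathbb Z$-graded $\mathbb Z[H_1(\Sigma)]$-module $\mathcal V(\Sigma,V)$ with finitely many nonzero summands (the ring being in degree $0$), and to each decorated-isotopy class of decorated morphisms $(\phi,\Gamma_c)$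 an additive map $\mathcal D_{\phi,\Gamma_c}:\mathcal V(\Sigma,V)\to\mathcal V(\Sigma',V')$, homogeneous of some degree and equivariant over the ring homomorphism $\phi_*:\mathbb Z[H_1(\Sigma)]\to\mathbb Z[H_1(\Sigma')]$. And $c$ assigns to each isotopy class (relative to endpoints) of sutures $\Gamma$ on $(\Sigma,V)$ an element $c(\Gamma)\in\mathcal V(\Sigma,V)$. It is required that: 1. each quadrangulation gives an isomorphism $\mathcal V(\Sigma,V)\cong\mathbb Z[H_1(\Sigma)]\otimes_{\mathbb Z}\bigotimes_i\mathcal V(\Sigma_i^\square,V_i^\square)$ (tensor products over $\mathbb Z$), under which $c(\Gamma)=1\otimes\bigotimes_i c(\Gamma_i)$ for basic $\Gamma$ restricting to $\Gamma_i$; 2. $\mathcal D_{\phi,\Gamma_c}(c(\Gamma))=c(\Gamma\cup\Gamma_c)$ for all sutures $\Gamma$ on $(\Sigma,V)$; 3. on a square, $\mathbf 1=c(\Gamma_+)$ and $\mathbf 0=c(\Gamma_-)$ form a free $\mathbb Z$-basis of $\mathcal V(\Sigma^\square,V^\square)$; 4. $\mathbf 0$ and $\mathbf 1$ have degrees $-1$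 and $1$, the isomorphisms in 1 respect the induced gradings, and $c(\Gamma)$ has degree $e(\Gamma)$ for every $\Gamma$. A **sanguine twisted SQFT** is defined in the same way (in particular $\mathcal D$ is still an honest functor), except that $c(\Gamma)\subset\mathcal V(\Sigma,V)$ is now the $\mathbb Z[H_1(\Sigma)]^\times$-orbit of an element; in 1, $c(\Gamma)$ corresponds to $\{u\otimes\bigotimes_i x_i : u\in\mathbb Z[H_1(\Sigma)]^\times,\ x_i\in c(\Gamma_i)\}$; in 2, $\mathcal D_{\phi,\Gamma_c}(c(\Gamma))\subseteq c(\Gamma\cup\Gamma_c)$; in 3, $c(\Gamma_+)=\{\pm\mathbf 1\}$ and $c(\Gamma_-)=\{\pm\mathbf 0\}$ for some free $\mathbb Z$-basis $\mathbf 0,\mathbf 1$ of $\mathcal V(\Sigma^\square,V^\square)$; and in 4, every element of $c(\Gamma)$ has degree $e(\Gamma)$. -/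

import Mathlib

open scoped TensorProduct Topology

universe u

noncomputable section

namespace TSQFT

/-! ### Occupied surfaces -/

/-- A map `f` of the plane preserves orientation at `z` when the image of every small circle
around `z` winds exactly once, counterclockwise, around `f z`. -/
def PreservesOrientationAt (f : ℂ → ℂ) (z : ℂ) : Prop :=
  ∀ᶠ r : ℝ in 𝓝[>] 0, ∃ θ : ℝ → ℝ, Continuous θ ∧
    (∀ t : ℝ, ∃ ρ : ℝ, 0 < ρ ∧
      f (z + r * Complex.exp (t * Complex.I)) - f z = ρ * Complex.exp (θ t * Complex.I)) ∧
    θ (2 * Real.pi) = θ 0 + 2 * Real.pi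

/-- `E` is a boundary edge: an embedded arc in the boundary `bd` running from a negative vertex to
a positive vertex and containing no vertex besides its endpoints. -/
def IsBoundaryEdge {X : Type} [TopologicalSpace X] (bd Vpos Vneg E : Set X) : Prop :=
  ∃ γ : C(unitInterval, X), Function.Injective γ ∧ Set.range γ = E ∧ E ⊆ bd ∧
    γ 0 ∈ Vneg ∧ γ 1 ∈ Vpos ∧ ∀ t, t ≠ 0 → t ≠ 1 → γ t ∉ Vpos ∪ Vneg

/-- An occupied surface: a compact oriented surface with boundary, possibly disconnected or empty,
with a finite set of signed vertices on the boundary, such that every component has nonempty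
boundary, every boundary component contains vertices, and the signs of the vertices alternate
along every boundary component. The orientation is an atlas of the interior with
orientation-preserving changes of charts. -/
structure OccupiedSurface where
  carrier : Type
  [topology : TopologicalSpace carrier]
  [compact : CompactSpace carrier]
  [hausdorff : T2Space carrier]
  /-- the boundary -/
  bd : Set carrier
  exists_chart : ∀ x : carrier, ∃ e : OpenPartialHomeomorph carrier (EuclideanHalfSpace 2),
    x ∈ e.source ∧ ∀ y ∈ e.source, y ∈ bd ↔ (e y).val 0 = 0
  /-- positively oriented charts of the interior -/
  atlas : Set (OpenPartialHomeomorph carrier ℂ)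
  atlas_interior : ∀ e ∈ atlas, e.source ⊆ bdᶜ
  atlas_cover : ∀ x ∉ bd, ∃ e ∈ atlas, x ∈ e.source
  atlas_compatible : ∀ e ∈ atlas, ∀ e' ∈ atlas, ∀ x ∈ e.source, x ∈ e'.source →
    PreservesOrientationAt (fun z => e' (e.symm z)) (e x)
  /-- positive vertices -/
  Vpos : Set carrier
  /-- negative vertices -/
  Vneg : Set carrier
  Vpos_finite : Vpos.Finite
  Vneg_finite : Vneg.Finite
  Vpos_subset : Vpos ⊆ bd
  Vneg_subset : Vneg ⊆ bd
  V_disjoint : Disjoint Vpos Vneg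
  component_bd : ∀ x : carrier, (connectedComponent x ∩ bd).Nonempty
  /-- Every boundary point that is not a vertex lies on a boundary edge, which joins a negative
  vertex to a positive one. As a boundary component is a circle, this says that each of them
  contains vertices and that their signs alternate. -/
  edge_cover : ∀ x ∈ bd, x ∉ Vpos ∪ Vneg → ∃ E, IsBoundaryEdge bd Vpos Vneg E ∧ x ∈ E

instance : CoeSort OccupiedSurface Type := ⟨OccupiedSurface.carrier⟩

attribute [instance] OccupiedSurface.topology OccupiedSurface.compact OccupiedSurface.hausdorff

namespace OccupiedSurface

/-- All vertices. -/
def V (S : OccupiedSurface) : Set S := S.Vpos ∪ S.Vneg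

/-- The boundary edges. -/
def edges (S : OccupiedSurface) : Set (Set S) := {E | IsBoundaryEdge S.bd S.Vpos S.Vneg E}

/-- An occupied square: a disc with four vertices. -/
def IsSquare (S : OccupiedSurface) : Prop :=
  Nonempty (S ≃ₜ Metric.closedBall (0 : ℂ) 1) ∧ S.V.ncard = 4

/-- The component of `x` is a vacuum: a disc with two vertices. -/
def InVacuum (S : OccupiedSurface) (x : S) : Prop :=
  Nonempty (connectedComponent x ≃ₜ Metric.closedBall (0 : ℂ) 1) ∧
    (connectedComponent x ∩ S.V).ncard = 2

end OccupiedSurface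

/-! ### Sutures -/

/-- A set of sutures `Γ` on a surface `X` with boundary `bd`, vertices `Vpos`, `Vneg` and boundary
edges `edges`, recorded by the two open regions into which it cuts `X`: the positive region
`pos` and the negative region `neg`; the sutures are the rest. Locally, `Γ` is a
properly embedded curve with the positive region on one side and the negative region on the other
side (so the orientations determine that of `Γ` as the oriented boundary of `pos`). Vertices lie in
the region of their sign, and each boundary edge contains exactly one endpoint of `Γ`. -/
structure SutureSet (X : Type) [TopologicalSpace X] (bd Vpos Vneg : Set X)
    (edges : Set (Set X)) where
  pos : Set X
  neg : Set X
  isOpen_pos : IsOpen pos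
  isOpen_neg : IsOpen neg
  disjoint : Disjoint pos neg
  Vpos_subset : Vpos ⊆ pos
  Vneg_subset : Vneg ⊆ neg
  exists_chart : ∀ x, x ∉ pos ∪ neg → ∃ e : OpenPartialHomeomorph X (EuclideanHalfSpace 2),
    x ∈ e.source ∧ ∀ y ∈ e.source,
      (y ∈ bd ↔ (e y).val 0 = 0) ∧ (y ∈ pos ↔ 0 < (e y).val 1) ∧ (y ∈ neg ↔ (e y).val 1 < 0)
  edge_unique : ∀ E ∈ edges, ∃! x, x ∈ E ∧ x ∉ pos ∪ neg

/-- The sutures, as a subset of the surface. -/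
def SutureSet.curve {X : Type} [TopologicalSpace X] {bd Vpos Vneg : Set X} {edges : Set (Set X)}
    (Γ : SutureSet X bd Vpos Vneg edges) : Set X := (Γ.pos ∪ Γ.neg)ᶜ

/-- Sets of sutures on an occupied surface. -/
abbrev Sutures (S : OccupiedSurface) : Type := SutureSet S S.bd S.Vpos S.Vneg S.edges

/-- `n` is the Euler characteristic of `A`: the alternating number of cells of a finite CW
structure on `A`. -/
def HasEulerChar {X : Type} [TopologicalSpace X] (A : Set X) (n : ℤ) : Prop :=
  ∃ cw : Topology.CWComplex A, Finite (Σ k, cw.cell k) ∧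
    n = ∑ᶠ k : ℕ, (-1 : ℤ) ^ k * (Nat.card (cw.cell k) : ℤ)

/-- `n` is the Euler class of `Γ`, the Euler characteristic of the positive region minus that of
the negative region (each computed from its closure, a compact surface with the same homotopy
type). -/
def HasEulerClass {S : OccupiedSurface} (Γ : Sutures S) (n : ℤ) : Prop :=
  ∃ a b : ℤ, HasEulerChar (closure Γ.pos) a ∧ HasEulerChar (closure Γ.neg) b ∧ n = a - b

/-- An ambient isotopy of an occupied surface: a continuous family of homeomorphisms starting at
the identity, preserving the boundary and fixing the vertices. -/
structure IsAmbientIsotopy {S : OccupiedSurface} (H : C(unitInterval × S, S)) : Prop where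
  bijective : ∀ t, Function.Bijective fun x => H (t, x)
  zero : ∀ x, H (0, x) = x
  bd : ∀ t x, H (t, x) ∈ S.bd ↔ x ∈ S.bd
  vertex : ∀ t, ∀ v ∈ S.V, H (t, v) = v

/-- Isotopy of sutures relative to endpoints. -/
def SutureIsotopic {S : OccupiedSurface} (Γ Δ : Sutures S) : Prop :=
  ∃ H : C(unitInterval × S, S), IsAmbientIsotopy H ∧ (∀ t, ∀ x ∈ S.bd, H (t, x) = x) ∧
    Δ.pos = (fun x => H (1, x)) '' Γ.pos ∧ Δ.neg = (fun x => H (1, x)) '' Γ.neg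

/-- The model square, with positive vertices `(1, 1)`, `(-1, -1)` and negative vertices
`(1, -1)`, `(-1, 1)`. -/
abbrev ModelSquare : Type := {p : ℝ × ℝ // |p.1| ≤ 1 ∧ |p.2| ≤ 1}

/-- The basic positive sutures on a square: two arcs, each of which cuts off a corner at a positive
vertex. -/
def IsBasicPos {S : OccupiedSurface} (Γ : Sutures S) : Prop :=
  ∃ h : S ≃ₜ ModelSquare, Γ.pos = {x | 1 < |(h x).1.1 + (h x).1.2|} ∧
    Γ.neg = {x | |(h x).1.1 + (h x).1.2| < 1}

/-- The basic negative sutures on a square: two arcs, each of which cuts off a corner at a negative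
vertex. -/
def IsBasicNeg {S : OccupiedSurface} (Γ : Sutures S) : Prop :=
  ∃ h : S ≃ₜ ModelSquare, Γ.neg = {x | 1 < |(h x).1.1 - (h x).1.2|} ∧
    Γ.pos = {x | |(h x).1.1 - (h x).1.2| < 1}

/-! ### Morphisms and decorated morphisms -/

/-- A morphism of occupied surfaces: a continuous map that embeds the interior, preserving
orientation. It embeds every boundary edge; the images of boundary edges of the source and the
boundary edges of the target either coincide or meet only at endpoints; and signs of vertices are
respected. -/
structure Morphism (S T : OccupiedSurface) where
  toFun : C(S, T)
  interior_embedding : Topology.IsOpenEmbedding (fun x : (S.bdᶜ : Set S) => toFun x)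
  interior_interior : ∀ x ∉ S.bd, toFun x ∉ T.bd
  orientation : ∀ e ∈ S.atlas, ∀ e' ∈ T.atlas, ∀ x ∈ e.source, toFun x ∈ e'.source →
    PreservesOrientationAt (fun z => e' (toFun (e.symm z))) (e x)
  edge_injective : ∀ E ∈ S.edges, Set.InjOn toFun E
  edge_edge : ∀ E ∈ S.edges, ∀ E' ∈ S.edges, toFun '' E = toFun '' E' ∨
    ∀ x ∈ E, ∀ y ∈ E', toFun x = toFun y → x ∈ S.V ∧ y ∈ S.V
  edge_target : ∀ E ∈ S.edges, ∀ E' ∈ T.edges, toFun '' E = E' ∨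
    ∀ x ∈ E, toFun x ∈ E' → x ∈ S.V ∧ toFun x ∈ T.V
  sign_source : ∀ v ∈ S.Vpos, ∀ w ∈ S.Vneg, toFun v ≠ toFun w
  sign_pos : ∀ v ∈ S.Vpos, toFun v ∉ T.Vneg
  sign_neg : ∀ v ∈ S.Vneg, toFun v ∉ T.Vpos

namespace Morphism

variable {S T : OccupiedSurface}

/-- The complement of the image, an occupied surface in its own right (regarded as a closed subset
of the target). -/
def complement (f : Morphism S T) : Set T := closure (Set.range f.toFun)ᶜ

/-- The boundary of the complement. -/
def complementBd (f : Morphism S T) : Set f.complement :=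
  {y | y.1 ∈ T.bd ∨ y.1 ∈ Set.range f.toFun}

/-- The positive vertices of the complement. -/
def complementVpos (f : Morphism S T) : Set f.complement :=
  {y | y.1 ∈ T.Vpos ∨ y.1 ∈ f.toFun '' S.Vpos}

/-- The negative vertices of the complement. -/
def complementVneg (f : Morphism S T) : Set f.complement :=
  {y | y.1 ∈ T.Vneg ∨ y.1 ∈ f.toFun '' S.Vneg}

/-- The boundary edges of the complement: those boundary edges of the target, and those images of
boundary edges of the source, that lie in it. -/
def complementEdges (f : Morphism S T) : Set (Set f.complement) :=
  {A | Subtype.val '' A ∈ T.edges ∨ ∃ E ∈ S.edges, Subtype.val '' A = f.toFun '' E}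

end Morphism

/-- A decorated morphism: a morphism with a set of sutures on the complement of its image. -/
structure DecoratedMorphism (S T : OccupiedSurface) extends Morphism S T where
  deco : SutureSet toMorphism.complement toMorphism.complementBd toMorphism.complementVpos
    toMorphism.complementVneg toMorphism.complementEdges

namespace DecoratedMorphism

variable {S T U : OccupiedSurface}

/-- The positive region of the decoration, as a subset of the target. -/
def decoPos (f : DecoratedMorphism S T) : Set T := Subtype.val '' f.deco.pos

/-- The negative region of the decoration, as a subset of the target. -/
def decoNeg (f : DecoratedMorphism S T) : Set T := Subtype.val '' f.deco.neg

/-- `f` sends the sutures `Γ` to `Δ`, the union of the image of `Γ` with the decoration of `f`. -/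
def Sends (f : DecoratedMorphism S T) (Γ : Sutures S) (Δ : Sutures T) : Prop :=
  Δ.pos = f.toFun '' Γ.pos ∪ f.decoPos ∧ Δ.neg = f.toFun '' Γ.neg ∪ f.decoNeg

/-- `f` is the identity (whose complement is empty). -/
def IsIdentity (f : DecoratedMorphism S S) : Prop := ∀ x, f.toFun x = x

/-- `h` is the composite of `f` followed by `g`: maps are composed, and the decoration of `h` is
the union of the decoration of `g` with the image under `g` of the decoration of `f`. -/
def IsComposite (f : DecoratedMorphism S T) (g : DecoratedMorphism T U)
    (h : DecoratedMorphism S U) : Prop :=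
  (∀ x, h.toFun x = g.toFun (f.toFun x)) ∧
    h.decoPos = g.toFun '' f.decoPos ∪ g.decoPos ∧ h.decoNeg = g.toFun '' f.decoNeg ∪ g.decoNeg

/-- `f` and `g` are joined by a continuous family of decorated morphisms, given by an ambient
isotopy of the target. -/
def AmbientIsotopic (f g : DecoratedMorphism S T) : Prop :=
  ∃ H : C(unitInterval × T, T), IsAmbientIsotopy H ∧
    (∀ x, g.toFun x = H (1, f.toFun x)) ∧
    g.decoPos = (fun x => H (1, x)) '' f.decoPos ∧ g.decoNeg = (fun x => H (1, x)) '' f.decoNeg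

/-- `g` arises from `f` by an isotopy that removes a vacuum at its end. The vacuum `B` is a disc in
the complement of `f`, bounded by the image of an edge `E` and by an arc `A` that is
another edge, and carries a single suture from `E` to `A`. The isotopy moves only the edge `E`
across `B` onto `A`. -/
def VacuumRemoval (f g : DecoratedMorphism S T) : Prop :=
  ∃ E ∈ S.edges, ∃ A B : Set T,
    (A ∈ T.edges ∨ ∃ E' ∈ S.edges, A = f.toFun '' E') ∧ B ⊆ f.complement ∧
    (∃ k : Metric.closedBall (0 : ℂ) 1 ≃ₜ B,
      (∀ z, (k z).1 ∈ f.toFun '' E ↔ ‖z.1‖ = 1 ∧ z.1.im ≤ 0) ∧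
      (∀ z, (k z).1 ∈ A ↔ ‖z.1‖ = 1 ∧ 0 ≤ z.1.im) ∧
      (∀ z, (k z).1 ∈ f.decoPos ↔ 0 < z.1.re) ∧ (∀ z, (k z).1 ∈ f.decoNeg ↔ z.1.re < 0)) ∧
    f.toFun '' E ⊆ B ∧ A ⊆ B ∧ Set.range g.toFun = Set.range f.toFun ∪ B ∧
    g.decoPos = f.decoPos ∩ g.complement ∧ g.decoNeg = f.decoNeg ∩ g.complement ∧
    ∃ Φ : C(unitInterval × S, T), (∀ x, Φ (0, x) = f.toFun x) ∧ (∀ x, Φ (1, x) = g.toFun x) ∧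
      (∀ t, ∃ m : Morphism S T, ∀ x, m.toFun x = Φ (t, x)) ∧
      (∀ t, ∀ x ∈ S.bd, x ∉ E → Φ (t, x) = f.toFun x) ∧ ∀ t, ∀ x ∈ E, Φ (t, x) ∈ B

/-- Decorated isotopy: the equivalence relation generated by continuous families of decorated
morphisms and by removal (or creation) of vacua. -/
def Isotopic : DecoratedMorphism S T → DecoratedMorphism S T → Prop :=
  Relation.EqvGen fun f g => AmbientIsotopic f g ∨ VacuumRemoval f g

end DecoratedMorphism

/-! ### Quadrangulations -/

/-- A quadrangulation of an occupied surface, as a finite family of squares mapped to it: each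
square is embedded except that its vertices may be identified, its vertices go to vertices,
different squares have disjoint interiors, their edges coincide or meet only in vertices, and
together they cover all of the surface except for its vacuum components (which have the null
quadrangulation). -/
structure Quadrangulation (S : OccupiedSurface) where
  ι : Type
  [fintype : Fintype ι]
  square : ι → OccupiedSurface
  isSquare : ∀ i, (square i).IsSquare
  map : ∀ i, Morphism (square i) S
  vertex : ∀ i, ∀ v ∈ (square i).V, (map i).toFun v ∈ S.V
  interior_disjoint : ∀ i j, i ≠ j → ∀ x ∉ (square i).bd, ∀ y ∉ (square j).bd,
    (map i).toFun x ≠ (map j).toFun y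
  edge_edge : ∀ i j, ∀ E ∈ (square i).edges, ∀ E' ∈ (square j).edges,
    (map i).toFun '' E = (map j).toFun '' E' ∨
      ∀ x ∈ E, ∀ y ∈ E', (map i).toFun x = (map j).toFun y →
        x ∈ (square i).V ∧ y ∈ (square j).V
  cover : ∀ x : S, (∃ i, x ∈ Set.range (map i).toFun) ∨ S.InVacuum x

attribute [instance] Quadrangulation.fintype

/-- `Γ` is basic for the quadrangulation `Q` and restricts to `Δ i` on the `i`-th square: each `Δ i`
is one of the two basic sets of sutures, and on every vacuum component `Γ` is a single arc. -/
def Quadrangulation.IsBasic {S : OccupiedSurface} (Q : Quadrangulation S) (Γ : Sutures S)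
    (Δ : ∀ i, Sutures (Q.square i)) : Prop :=
  (∀ i, (Δ i).pos = (Q.map i).toFun ⁻¹' Γ.pos ∧ (Δ i).neg = (Q.map i).toFun ⁻¹' Γ.neg ∧
    (IsBasicPos (Δ i) ∨ IsBasicNeg (Δ i))) ∧
  ∀ x : S, S.InVacuum x → IsConnected (connectedComponent x ∩ Γ.curve)

/-! ### Coefficients -/

/-- First singular homology with integer coefficients. -/
abbrev H1 (X : Type) [TopologicalSpace X] : ModuleCat.{0} ℤ :=
  ((AlgebraicTopology.singularHomologyFunctor (ModuleCat.{0} ℤ) 1).obj (ModuleCat.of ℤ ℤ)).obj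
    (TopCat.of X)

/-- The group ring `ℤ[H₁(X)]`. -/
abbrev GroupRing (X : Type) [TopologicalSpace X] : Type := AddMonoidAlgebra ℤ (H1 X)

/-- The ring homomorphism `ℤ[H₁(X)] → ℤ[H₁(Y)]` induced by a continuous map. -/
def GroupRing.map {X Y : Type} [TopologicalSpace X] [TopologicalSpace Y] (f : C(X, Y)) :
    GroupRing X →+* GroupRing Y :=
  AddMonoidAlgebra.mapDomainRingHom ℤ
    (((AlgebraicTopology.singularHomologyFunctor (ModuleCat.{0} ℤ) 1).obj
      (ModuleCat.of ℤ ℤ)).map (TopCat.ofHom f)).hom.toAddMonoidHom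

/-! ### Twisted theories -/

/-- A functor from the decorated occupied surface category to a graded module category, which
assigns to an occupied surface a graded module over its group ring, and to a decorated-isotopy
class of decorated morphisms a graded module homomorphism, of some degree, over the ring
homomorphism induced by the morphism. -/
structure TwistedFunctor where
  V : OccupiedSurface → Type u
  [addCommGroup : ∀ S : OccupiedSurface, AddCommGroup (V S)]
  [module : ∀ S : OccupiedSurface, Module (GroupRing S) (V S)]
  /-- the graded summands -/
  gr : ∀ S : OccupiedSurface, ℤ → Submodule (GroupRing S) (V S)
  gr_internal : ∀ S : OccupiedSurface, DirectSum.IsInternal (gr S)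
  gr_finite : ∀ S : OccupiedSurface, {n | gr S n ≠ ⊥}.Finite
  D : ∀ {S T : OccupiedSurface}, DecoratedMorphism S T → V S →+ V T
  D_smul : ∀ {S T : OccupiedSurface} (f : DecoratedMorphism S T) (r : GroupRing S) (x : V S),
    D f (r • x) = GroupRing.map f.toFun r • D f x
  D_graded : ∀ {S T : OccupiedSurface} (f : DecoratedMorphism S T),
    ∃ d : ℤ, ∀ n, ∀ x ∈ gr S n, D f x ∈ gr T (n + d)
  D_isotopic : ∀ {S T : OccupiedSurface} (f g : DecoratedMorphism S T), f.Isotopic g → D f = D g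
  D_identity : ∀ {S : OccupiedSurface} (f : DecoratedMorphism S S),
    f.IsIdentity → D f = AddMonoidHom.id (V S)
  D_composite : ∀ {S T U : OccupiedSurface} (f : DecoratedMorphism S T) (g : DecoratedMorphism T U)
    (h : DecoratedMorphism S U), f.IsComposite g h → D h = (D g).comp (D f)

attribute [instance] TwistedFunctor.addCommGroup TwistedFunctor.module

/-- The right-hand side of the tensor decomposition given by a quadrangulation; the tensor products
are over `ℤ`. -/
abbrev TwistedFunctor.Tensor (𝓕 : TwistedFunctor.{u}) {S : OccupiedSurface}
    (Q : Quadrangulation S) :=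
  GroupRing S ⊗[ℤ] (⨂[ℤ] i, 𝓕.V (Q.square i))

/-- An isomorphism onto the tensor decomposition of a quadrangulation is graded when the grading of
`V S` is the one induced by the gradings of the squares, with coefficients in degree `0`. -/
def TwistedFunctor.IsGradedIso (𝓕 : TwistedFunctor.{u}) {S : OccupiedSurface}
    (Q : Quadrangulation S) (e : 𝓕.V S ≃ₗ[GroupRing S] 𝓕.Tensor Q) : Prop :=
  ∀ (r : GroupRing S) (n : Q.ι → ℤ) (x : ∀ i, 𝓕.V (Q.square i)),
    (∀ i, x i ∈ 𝓕.gr (Q.square i) (n i)) →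
      e.symm (r ⊗ₜ[ℤ] PiTensorProduct.tprod ℤ x) ∈ 𝓕.gr S (∑ i, n i)

/-- An optimistic twisted SQFT. -/
structure OptimisticTSQFT extends TwistedFunctor.{u} where
  /-- suture elements -/
  c : ∀ {S : OccupiedSurface}, Sutures S → V S
  c_isotopic : ∀ {S : OccupiedSurface} (Γ Δ : Sutures S), SutureIsotopic Γ Δ → c Γ = c Δ
  tensor : ∀ {S : OccupiedSurface} (Q : Quadrangulation S),
    ∃ e : V S ≃ₗ[GroupRing S] toTwistedFunctor.Tensor Q,
      toTwistedFunctor.IsGradedIso Q e ∧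
      ∀ (Γ : Sutures S) (Δ : ∀ i, Sutures (Q.square i)), Q.IsBasic Γ Δ →
        e (c Γ) = 1 ⊗ₜ[ℤ] PiTensorProduct.tprod ℤ fun i => c (Δ i)
  respects : ∀ {S T : OccupiedSurface} (f : DecoratedMorphism S T) (Γ : Sutures S) (Δ : Sutures T),
    f.Sends Γ Δ → D f (c Γ) = c Δ
  basis : ∀ S : OccupiedSurface, S.IsSquare → ∃ zero one : V S,
    (∀ Γ : Sutures S, IsBasicPos Γ → c Γ = one) ∧ (∀ Γ : Sutures S, IsBasicNeg Γ → c Γ = zero) ∧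
    LinearIndependent ℤ ![zero, one] ∧ Submodule.span ℤ {zero, one} = ⊤ ∧
    zero ∈ gr S (-1) ∧ one ∈ gr S 1
  euler : ∀ {S : OccupiedSurface} (Γ : Sutures S) (n : ℤ), HasEulerClass Γ n → c Γ ∈ gr S n

/-- A sanguine twisted SQFT: suture elements are only defined up to units, while module
homomorphisms are honest. -/
structure SanguineTSQFT extends TwistedFunctor.{u} where
  /-- orbits of suture elements -/
  c : ∀ {S : OccupiedSurface}, Sutures S → Set (V S)
  c_orbit : ∀ {S : OccupiedSurface} (Γ : Sutures S),
    ∃ x : V S, c Γ = {y | ∃ u : (GroupRing S)ˣ, y = u.val • x}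
  c_isotopic : ∀ {S : OccupiedSurface} (Γ Δ : Sutures S), SutureIsotopic Γ Δ → c Γ = c Δ
  tensor : ∀ {S : OccupiedSurface} (Q : Quadrangulation S),
    ∃ e : V S ≃ₗ[GroupRing S] toTwistedFunctor.Tensor Q,
      toTwistedFunctor.IsGradedIso Q e ∧
      ∀ (Γ : Sutures S) (Δ : ∀ i, Sutures (Q.square i)), Q.IsBasic Γ Δ →
        e '' c Γ = {y | ∃ (u : (GroupRing S)ˣ) (x : ∀ i, V (Q.square i)),
          (∀ i, x i ∈ c (Δ i)) ∧ y = u.val ⊗ₜ[ℤ] PiTensorProduct.tprod ℤ x}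
  respects : ∀ {S T : OccupiedSurface} (f : DecoratedMorphism S T) (Γ : Sutures S) (Δ : Sutures T),
    f.Sends Γ Δ → D f '' c Γ ⊆ c Δ
  basis : ∀ S : OccupiedSurface, S.IsSquare → ∃ zero one : V S,
    (∀ Γ : Sutures S, IsBasicPos Γ → c Γ = {one, -one}) ∧
    (∀ Γ : Sutures S, IsBasicNeg Γ → c Γ = {zero, -zero}) ∧
    LinearIndependent ℤ ![zero, one] ∧ Submodule.span ℤ {zero, one} = ⊤ ∧
    zero ∈ gr S (-1) ∧ one ∈ gr S 1
  euler : ∀ {S : OccupiedSurface} (Γ : Sutures S) (n : ℤ),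
    HasEulerClass Γ n → ∀ y ∈ c Γ, y ∈ gr S n

end TSQFT

end

/-! Take a disc with eight vertices. Its quarter turn ρ preserves the signs of the vertices, and ρ²
is the half turn. Cut the disc into three squares in a row. The tensor decomposition gives a basis
indexed by a choice of `0` or `1` on each square, with degree the sum of the signs, so degree -1 has
rank three: exactly one square carries `1`. The three basis vectors are realized by three sets of
sutures. The half turn fixes the one whose positive square is the middle one and exchanges the other
two.

Hence `D ρ²` permutes a basis of the degree -1 summand by a transposition, up to units, and has
determinant -1 there. But `D ρ²` is the square of `D ρ`, and `D ρ` must have degree 0, so it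
restricts to the same summand. Its determinant would be an integer with square -1. The obstruction
is thus that the transposition has a square root in the mapping class group but none in the matrices
over `ℤ`. This is `false_of_sq_swap`. The maps are only semilinear over the group ring; since the
augmentation to `ℤ` is compatible with every induced ring homomorphism, applying it to coordinates
leaves an honest integer matrix, and the homology of the disc need not be computed.

In the optimistic case the permuted vectors are the suture elements. In the sanguine case these are
known only up to units, so consistent representatives are needed. A set of sutures is also a
decorated morphism from the empty surface, and a fixed element of `c(∅)` pushed forward along these
morphisms gives representatives that functoriality permutes exactly. Both cases end in
`TwistedFunctor.false_of_suture_elements`.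

Most of the work is the explicit model. In rectangular coordinates on `[-1, 1] × [-3, 3]` the
squares are stacked rectangles and the sutures are zero sets of a triangle wave. The homeomorphism
`planar` carries this rectangle to an octagon in `ℂ` on which ρ is multiplication by `I`. -/

noncomputable section

namespace TSQFT

/-! ### Graded modules and the determinant obstruction -/

section Algebra

/-- Homogeneous elements of a graded module have only homogeneous coordinates of the same degree
with respect to a homogeneous basis. -/
lemma repr_eq_zero_of_mem_graded {A M κ : Type*} [CommRing A] [AddCommGroup M] [Module A M]
    [Fintype κ] {gr : ℤ → Submodule A M} (hgr : DirectSum.IsInternal gr)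
    (b : Module.Basis κ A M) {deg : κ → ℤ} (hb : ∀ k, b k ∈ gr (deg k)) {n : ℤ} {v : M}
    (hv : v ∈ gr n) {k : κ} (hk : deg k ≠ n) : b.repr v k = 0 := by
  classical
  -- The part of `v` off degree `n` lies both in `gr n`, as a difference, and in the sum of the
  -- other summands, so it vanishes by independence.
  set w : M := ∑ k with deg k ≠ n, b.repr v k • b k with hw
  have hsum : (∑ k with deg k = n, b.repr v k • b k) + w = v := by
    rw [hw, Finset.sum_filter_add_sum_filter_not, b.sum_repr]
  have h1 : w ∈ gr n := by
    have : w = v - ∑ k with deg k = n, b.repr v k • b k := eq_sub_of_add_eq' hsum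
    rw [this]
    refine Submodule.sub_mem _ hv (Submodule.sum_mem _ fun k hk => Submodule.smul_mem _ _ ?_)
    rw [← (Finset.mem_filter.1 hk).2]
    exact hb k
  have h2 : w ∈ ⨆ m ≠ n, gr m := by
    refine Submodule.sum_mem _ fun k hk => Submodule.smul_mem _ _ ?_
    exact Submodule.mem_iSup_of_mem (deg k)
      (Submodule.mem_iSup_of_mem (Finset.mem_filter.1 hk).2 (hb k))
  have h0 : w = 0 := (Submodule.disjoint_def.1 (hgr.submodule_iSupIndep n)) w h1 h2
  have h3 : b.repr w k = b.repr v k := by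
    rw [hw, map_sum, Finset.sum_apply']
    rw [Finset.sum_eq_single k]
    · simp
    · intro l _ hl
      simp [hl]
    · intro h
      simp [hk] at h
  rw [← h3, h0]
  simp

/-- If the square of a homogeneous semilinear endomorphism fixes one and exchanges two further
elements, it is not the case that these are, up to units, a homogeneous basis of a graded
summand: modulo the augmentation, the determinant of the square would be `-1`. -/
lemma false_of_sq_swap {A M κ : Type*} [CommRing A] [AddCommGroup M] [Module A M]
    [Fintype κ] {gr : ℤ → Submodule A M} (hgr : DirectSum.IsInternal gr)
    (b : Module.Basis κ A M) {deg : κ → ℤ} (hb : ∀ k, b k ∈ gr (deg k))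
    (ε : A →+* ℤ) (σ : A →+* A) (hσ : ∀ r, ε (σ r) = ε r) (R : M →+ M)
    (hR : ∀ r x, R (r • x) = σ r • R x) {d : ℤ} (hd : ∀ n, ∀ x ∈ gr n, R x ∈ gr (n + d))
    {n : ℤ} (idx : Fin 3 → κ) (hinj : Function.Injective idx)
    (hidx : ∀ k, deg k = n ↔ k ∈ Set.range idx) (a : Fin 3 → M) (w : Fin 3 → Aˣ)
    (ha : ∀ j, a j = (w j).val • b (idx j)) (h0 : R (R (a 0)) = a 0) (h1 : R (R (a 1)) = a 2)
    (h2 : R (R (a 2)) = a 1) : False := by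
  classical
  have hdeg : ∀ j, deg (idx j) = n := fun j => (hidx _).2 ⟨j, rfl⟩
  have ha_mem : ∀ j, a j ∈ gr n := fun j => by
    rw [ha, ← hdeg j]
    exact Submodule.smul_mem _ _ (hb _)
  have hε : ∀ j, ε (w j).val ≠ 0 := fun j => ((w j).isUnit.map ε).ne_zero
  have hrepr : ∀ j k, ε (b.repr (a j) k) = if k = idx j then ε (w j).val else 0 := by
    intro j k
    rw [ha, map_smul, b.repr_self]
    by_cases h : k = idx j
    · simp [h]
    · simp [h]
  -- The square of `R` shifts degrees by `2d` and fixes `a 0`, which has a nonzero coordinate in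
  -- degree `n`.
  have hd0 : d = 0 := by
    by_contra hne
    have hmem : a 0 ∈ gr (n + d + d) := by
      have := hd _ _ (hd _ _ (ha_mem 0))
      rwa [h0] at this
    have hz := repr_eq_zero_of_mem_graded hgr b hb hmem (k := idx 0) (by rw [hdeg]; omega)
    have := hrepr 0 (idx 0)
    rw [hz, map_zero, if_pos rfl] at this
    exact hε 0 this.symm
  subst hd0
  -- After augmentation the twist `σ` disappears, so coordinates transform by an integer matrix.
  have hcomp : ∀ v k, ε (b.repr (R v) k) = ∑ l, ε (b.repr v l) * ε (b.repr (R (b l)) k) := by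
    intro v k
    conv_lhs => rw [← b.sum_repr v]
    rw [map_sum, map_sum, Finset.sum_apply', map_sum]
    refine Finset.sum_congr rfl fun l _ => ?_
    rw [hR, map_smul, Finsupp.smul_apply, smul_eq_mul, map_mul, hσ]
  let N : Matrix (Fin 3) (Fin 3) ℤ := fun i j => ε (b.repr (R (b (idx j))) (idx i))
  have hN : ∀ i j, (N * N) i j = ε (b.repr (R (R (b (idx j)))) (idx i)) := by
    intro i j
    rw [hcomp, Matrix.mul_apply]
    -- As `R` has degree 0, the image of a basis vector of degree `n` has no coordinates off degree
    -- `n`; the full matrix product therefore reduces to the `3 × 3` block.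
    refine Fintype.sum_of_injective idx hinj _ _ (fun k hk => ?_) fun k => mul_comm _ _
    have hm : R (b (idx j)) ∈ gr n := by
      have := hd _ _ (hb (idx j))
      rwa [hdeg, add_zero] at this
    rw [repr_eq_zero_of_mem_graded hgr b hb hm fun h => hk ((hidx k).1 h)]
    simp
  have hRR : ∀ i j, ε (b.repr (R (R (a j))) (idx i)) = (N * N) i j * ε (w j).val := by
    intro i j
    rw [hN, ha, hR, hR, map_smul, Finsupp.smul_apply, smul_eq_mul, map_mul, hσ, hσ, mul_comm]
  -- The columns are the augmented coordinates of `a 0`, `a 2`, `a 1`, so the determinant on the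
  -- right is minus the product of the three unit values, which cancels against the diagonal factor.
  have hP : (N * N) * Matrix.diagonal (fun j => ε (w j).val) =
      !![ε (w 0).val, 0, 0; 0, 0, ε (w 1).val; 0, ε (w 2).val, 0] := by
    ext i j
    rw [Matrix.mul_diagonal, ← hRR]
    have key : ∀ i j, ε (b.repr (a j) (idx i)) = if i = j then ε (w j).val else 0 := by
      intro i j
      rw [hrepr]
      simp [hinj.eq_iff]
    fin_cases j
    · simp only [Fin.zero_eta, h0, key]
      fin_cases i <;> simp
    · simp only [Fin.mk_one, h1, key]
      fin_cases i <;> simp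
    · simp only [Fin.reduceFinMk, h2, key]
      fin_cases i <;> simp
  have hdet := congrArg Matrix.det hP
  rw [Matrix.det_mul, Matrix.det_mul, Matrix.det_diagonal, Fin.prod_univ_three] at hdet
  have hne : ε (w 0).val * ε (w 1).val * ε (w 2).val ≠ 0 :=
    mul_ne_zero (mul_ne_zero (hε 0) (hε 1)) (hε 2)
  have hsq : N.det * N.det = -1 := mul_right_cancel₀ hne (by
    rw [hdet]
    simp [Matrix.det_fin_three])
  nlinarith [mul_self_nonneg N.det]

/-- The augmentation of a group ring. -/
def GroupRing.aug (X : Type) [TopologicalSpace X] : GroupRing X →+* ℤ :=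
  (AddMonoidAlgebra.lift ℤ ℤ (H1 X) 1).toRingHom

/-- Pushing group elements forward does not change the sum of the coefficients. This is what makes
the semilinear maps linear after augmentation. -/
lemma GroupRing.aug_map {X Y : Type} [TopologicalSpace X] [TopologicalSpace Y] (f : C(X, Y))
    (r : GroupRing X) : GroupRing.aug Y (GroupRing.map f r) = GroupRing.aug X r := by
  have : (GroupRing.aug Y).comp (GroupRing.map f) = GroupRing.aug X := by
    refine AddMonoidAlgebra.ringHom_ext (fun r => ?_) fun m => ?_ <;>
      simp [GroupRing.aug, GroupRing.map]
  exact DFunLike.congr_fun this r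

/-- A quadrangulation induces a homogeneous basis over the group ring, given bases of the modules
of the squares. -/
lemma TwistedFunctor.exists_basis (𝓕 : TwistedFunctor.{u}) {S : OccupiedSurface}
    (Q : Quadrangulation S) (e : 𝓕.V S ≃ₗ[GroupRing S] 𝓕.Tensor Q) (he : 𝓕.IsGradedIso Q e)
    (zero one : ∀ i, 𝓕.V (Q.square i))
    (hli : ∀ i, LinearIndependent ℤ ![zero i, one i])
    (hspan : ∀ i, Submodule.span ℤ {zero i, one i} = ⊤)
    (hzero : ∀ i, zero i ∈ 𝓕.gr (Q.square i) (-1)) (hone : ∀ i, one i ∈ 𝓕.gr (Q.square i) 1) :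
    ∃ b : Module.Basis (Q.ι → Fin 2) (GroupRing S) (𝓕.V S),
      (∀ k, e (b k) = 1 ⊗ₜ[ℤ] PiTensorProduct.tprod ℤ fun i => ![zero i, one i] (k i)) ∧
      ∀ k, b k ∈ 𝓕.gr S (∑ i, ![-1, 1] (k i)) := by
  have hs : ∀ i, ⊤ ≤ Submodule.span ℤ (Set.range ![zero i, one i]) := fun i => by
    rw [Matrix.range_cons_cons_empty, hspan]
  let b₀ : ∀ i, Module.Basis (Fin 2) ℤ (𝓕.V (Q.square i)) := fun i => .mk (hli i) (hs i)
  let b := ((Basis.piTensorProduct b₀).baseChange (GroupRing S)).map e.symm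
  have hb : ∀ k, e (b k) = 1 ⊗ₜ[ℤ] PiTensorProduct.tprod ℤ fun i => ![zero i, one i] (k i) := by
    intro k
    simp [b, b₀, Basis.piTensorProduct_apply]
  refine ⟨b, hb, fun k => ?_⟩
  have := he 1 (fun i => ![-1, 1] (k i)) (fun i => ![zero i, one i] (k i)) fun i => by
    generalize k i = j
    fin_cases j
    · exact hzero i
    · exact hone i
  rwa [← hb, LinearEquiv.symm_apply_apply] at this

end Algebra

/-! ### Vertices and arcs of the subdivided rectangle -/

section Arcs

/-- The positive vertices of the octagon, in rectangular coordinates. -/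
def posVertices : Set (ℝ × ℝ) := {(1, 1), (-1, 3), (-1, -1), (1, -3)}

/-- The negative vertices of the octagon, in rectangular coordinates. -/
def negVertices : Set (ℝ × ℝ) := {(-1, 1), (1, 3), (1, -1), (-1, -3)}

lemma mem_posVertices {q : ℝ × ℝ} : q ∈ posVertices ↔ (q.1 = 1 ∧ q.2 = 1) ∨
    (q.1 = -1 ∧ q.2 = 3) ∨ (q.1 = -1 ∧ q.2 = -1) ∨ (q.1 = 1 ∧ q.2 = -3) := by
  simp [posVertices, Prod.ext_iff]

lemma mem_negVertices {q : ℝ × ℝ} : q ∈ negVertices ↔ (q.1 = -1 ∧ q.2 = 1) ∨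
    (q.1 = 1 ∧ q.2 = 3) ∨ (q.1 = 1 ∧ q.2 = -1) ∨ (q.1 = -1 ∧ q.2 = -3) := by
  simp [negVertices, Prod.ext_iff]

/-- The heights of the vertices. -/
def IsLevel (t : ℝ) : Prop := t = -3 ∨ t = -1 ∨ t = 1 ∨ t = 3

lemma mem_vertices {q : ℝ × ℝ} : q ∈ posVertices ∪ negVertices ↔
    (q.1 = 1 ∨ q.1 = -1) ∧ IsLevel q.2 := by
  rw [Set.mem_union, mem_posVertices, mem_negVertices, IsLevel]
  tauto

lemma disjoint_vertices : Disjoint posVertices negVertices := by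
  rw [Set.disjoint_left]
  intro q hp hn
  rw [mem_posVertices] at hp
  rw [mem_negVertices] at hn
  rcases hp with h | h | h | h <;> rcases hn with h' | h' | h' | h' <;> linarith [h.1, h.2, h'.1, h'.2]

/-- A vertical arc between consecutive vertices. -/
def sideArc (ε k : ℝ) : Set (ℝ × ℝ) := {q | q.1 = ε ∧ k ≤ q.2 ∧ q.2 ≤ k + 2}

/-- A horizontal arc between vertices. -/
def levelArc (t : ℝ) : Set (ℝ × ℝ) := {q | -1 ≤ q.1 ∧ q.1 ≤ 1 ∧ q.2 = t}

/-- The arcs joining adjacent vertices: the edges of the octagon and of the squares into which it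
is cut. -/
def IsArc (A : Set (ℝ × ℝ)) : Prop :=
  (∃ ε k : ℝ, (ε = 1 ∨ ε = -1) ∧ (k = -3 ∨ k = -1 ∨ k = 1) ∧ A = sideArc ε k) ∨
    ∃ t, IsLevel t ∧ A = levelArc t

lemma IsArc.isClosed {A : Set (ℝ × ℝ)} (hA : IsArc A) : IsClosed A := by
  rcases hA with ⟨ε, k, _, _, rfl⟩ | ⟨t, _, rfl⟩
  · exact (isClosed_eq continuous_fst continuous_const).inter
      ((isClosed_le continuous_const continuous_snd).inter
        (isClosed_le continuous_snd continuous_const))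
  · exact (isClosed_le continuous_const continuous_fst).inter
      ((isClosed_le continuous_fst continuous_const).inter
        (isClosed_eq continuous_snd continuous_const))

/-- Away from the vertices, arcs are open in the union of all arcs. -/
lemma IsArc.exists_isOpen {A : Set (ℝ × ℝ)} (hA : IsArc A) : ∃ U, IsOpen U ∧
    ∀ B, IsArc B → ∀ q ∈ B, q ∉ posVertices ∪ negVertices → (q ∈ A ↔ q ∈ U) := by
  rcases hA with ⟨ε, k, hε, hk, rfl⟩ | ⟨t, ht, rfl⟩
  -- Strictly between consecutive levels the only arcs are the two vertical ones, and the sign of `ε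
  -- * q.1` separates them.
  · refine ⟨{q | 0 < ε * q.1 ∧ k < q.2 ∧ q.2 < k + 2}, ?_, ?_⟩
    · exact (isOpen_lt continuous_const (continuous_const.mul continuous_fst)).inter
        ((isOpen_lt continuous_const continuous_snd).inter
          (isOpen_lt continuous_snd continuous_const))
    · rintro B (⟨ε', k', hε', hk', rfl⟩ | ⟨t', ht', rfl⟩) q hq hv <;>
        rw [mem_vertices, IsLevel] at hv
      · obtain ⟨h1, h2, h3⟩ := hq
        rw [h1] at hv
        constructor
        · rintro ⟨h4, h5, h6⟩
          refine ⟨?_, ?_, ?_⟩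
          · rw [h4]
            rcases hε with rfl | rfl <;> norm_num
          · refine lt_of_le_of_ne h5 fun h => hv ⟨hε', ?_⟩
            rw [← h]; tauto
          · refine lt_of_le_of_ne h6 fun h => hv ⟨hε', ?_⟩
            rw [h]; rcases hk with rfl | rfl | rfl <;> norm_num
        · rintro ⟨h4, h5, h6⟩
          refine ⟨?_, h5.le, h6.le⟩
          rw [h1] at h4 ⊢
          rcases hε with rfl | rfl <;> rcases hε' with rfl | rfl <;> first | rfl | linarith
      · obtain ⟨h1, h2, h3⟩ := hq
        have : ¬ (q.1 = 1 ∨ q.1 = -1) := fun h => hv ⟨h, h3 ▸ ht'⟩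
        constructor
        · rintro ⟨h4, -, -⟩
          exact absurd (h4 ▸ hε) this
        · rintro ⟨-, h5, h6⟩
          rw [h3] at h5 h6
          exfalso
          rcases hk with rfl | rfl | rfl <;> rcases ht' with rfl | rfl | rfl | rfl <;> linarith
  -- The bounds on `q.1` exclude the vertical arcs, and distinct levels are at least 2 apart.
  · refine ⟨{q | -1 < q.1 ∧ q.1 < 1 ∧ t - 1 < q.2 ∧ q.2 < t + 1}, ?_, ?_⟩
    · exact (isOpen_lt continuous_const continuous_fst).inter
        ((isOpen_lt continuous_fst continuous_const).inter
          ((isOpen_lt continuous_const continuous_snd).inter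
            (isOpen_lt continuous_snd continuous_const)))
    · rintro B (⟨ε', k', hε', hk', rfl⟩ | ⟨t', ht', rfl⟩) q hq hv <;>
        rw [mem_vertices] at hv
      · obtain ⟨h1, h2, h3⟩ := hq
        constructor
        · rintro ⟨-, -, h4⟩
          exact absurd ⟨h1 ▸ hε', h4 ▸ ht⟩ hv
        · rintro ⟨h4, h5, -⟩
          exfalso
          rcases hε' with rfl | rfl <;> linarith
      · obtain ⟨h1, h2, h3⟩ := hq
        rw [h3] at hv
        constructor
        · rintro ⟨-, -, h4⟩
          refine ⟨?_, ?_, by linarith, by linarith⟩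
          · exact lt_of_le_of_ne h1 fun h => hv ⟨.inr h.symm, ht'⟩
          · exact lt_of_le_of_ne h2 fun h => hv ⟨.inl h, ht'⟩
        · rintro ⟨-, -, h4, h5⟩
          refine ⟨h1, h2, ?_⟩
          rw [h3] at h4 h5 ⊢
          rcases ht with rfl | rfl | rfl | rfl <;> rcases ht' with rfl | rfl | rfl | rfl <;>
            first | rfl | linarith

/-- Two arcs that share a point other than a vertex coincide. -/
lemma IsArc.eq_of_mem {A B : Set (ℝ × ℝ)} (hA : IsArc A) (hB : IsArc B) {q : ℝ × ℝ}
    (hqA : q ∈ A) (hqB : q ∈ B) (hq : q ∉ posVertices ∪ negVertices) : A = B := by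
  rw [mem_vertices, IsLevel] at hq
  rcases hA with ⟨ε, k, hε, hk, rfl⟩ | ⟨t, ht, rfl⟩ <;>
    rcases hB with ⟨ε', k', hε', hk', rfl⟩ | ⟨t', ht', rfl⟩
  · obtain ⟨rfl, h1, h2⟩ := hqA
    obtain ⟨rfl, h3, h4⟩ := hqB
    have hq' := not_and.1 hq hε
    push Not at hq'
    congr 1
    rcases hk with rfl | rfl | rfl <;> rcases hk' with rfl | rfl | rfl <;>
      first
        | rfl
        | (exfalso; linarith)
        | (exfalso; exact hq'.2.1 (by linarith))
        | (exfalso; exact hq'.2.2.1 (by linarith))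
  · exact absurd ⟨hqA.1 ▸ hε, hqB.2.2 ▸ ht'⟩ hq
  · exact absurd ⟨hqB.1 ▸ hε', hqA.2.2 ▸ ht⟩ hq
  · rw [← hqA.2.2, ← hqB.2.2]

/-- An arc can be parametrized as a boundary edge. -/
lemma IsArc.exists_path {A : Set (ℝ × ℝ)} (hA : IsArc A) : ∃ γ : C(unitInterval, ℝ × ℝ),
    Function.Injective γ ∧ Set.range γ = A ∧ γ 0 ∈ negVertices ∧ γ 1 ∈ posVertices ∧
      ∀ s, s ≠ 0 → s ≠ 1 → γ s ∉ posVertices ∪ negVertices := by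
  have key : ∀ n p : ℝ × ℝ, n ∈ negVertices → p ∈ posVertices →
      (∀ q, q ∈ A ↔ ∃ s : ℝ, 0 ≤ s ∧ s ≤ 1 ∧ q = n + s • (p - n)) →
      (∀ s : ℝ, 0 < s → s < 1 → n + s • (p - n) ∉ posVertices ∪ negVertices) →
      ∃ γ : C(unitInterval, ℝ × ℝ),
        Function.Injective γ ∧ Set.range γ = A ∧ γ 0 ∈ negVertices ∧ γ 1 ∈ posVertices ∧
          ∀ s, s ≠ 0 → s ≠ 1 → γ s ∉ posVertices ∪ negVertices := by
    intro n p hn hp hA hint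
    have hne : p - n ≠ 0 := fun h => Set.disjoint_left.1 disjoint_vertices hp
      ((sub_eq_zero.1 h) ▸ hn)
    refine ⟨⟨fun s => n + s.1 • (p - n), by fun_prop⟩, ?_, ?_, ?_, ?_, ?_⟩
    · intro s s' h
      exact Subtype.ext (smul_left_injective ℝ hne (add_left_cancel h))
    · ext q
      rw [hA]
      constructor
      · rintro ⟨s, rfl⟩
        exact ⟨s.1, s.2.1, s.2.2, rfl⟩
      · rintro ⟨s, h0, h1, rfl⟩
        exact ⟨⟨s, h0, h1⟩, rfl⟩
    · simpa using hn
    · simpa using hp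
    · intro s h0 h1
      exact hint s (lt_of_le_of_ne s.2.1 fun h => h0 (Subtype.ext h.symm))
        (lt_of_le_of_ne s.2.2 fun h => h1 (Subtype.ext h))
  have side : ∀ ε k, A = sideArc ε k → ∀ q, q ∈ A ↔
      (∃ s : ℝ, 0 ≤ s ∧ s ≤ 1 ∧ q = (ε, k) + s • ((ε, k + 2) - (ε, k))) := by
    rintro ε k rfl q
    constructor
    · rintro ⟨h1, h2, h3⟩
      exact ⟨(q.2 - k) / 2, by linarith, by linarith, Prod.ext (by simp [h1]) (by simp)⟩
    · rintro ⟨s, h0, h1, rfl⟩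
      refine ⟨by simp, ?_, ?_⟩ <;> simp <;> linarith
  have level : ∀ t, A = levelArc t → ∀ q, q ∈ A ↔
      (∃ s : ℝ, 0 ≤ s ∧ s ≤ 1 ∧ q = (-1, t) + s • ((1, t) - (-1, t))) := by
    rintro t rfl q
    constructor
    · rintro ⟨h1, h2, h3⟩
      exact ⟨(q.1 + 1) / 2, by linarith, by linarith, Prod.ext (by simp; ring) (by simp [h3])⟩
    · rintro ⟨s, h0, h1, rfl⟩
      refine ⟨?_, ?_, by simp⟩ <;> simp <;> linarith
  -- Signs alternate from level to level, so half of the arcs have to be traversed backwards to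
  -- start at a negative vertex.
  have rev : ∀ n p : ℝ × ℝ,
      (∀ q, q ∈ A ↔ ∃ s : ℝ, 0 ≤ s ∧ s ≤ 1 ∧ q = n + s • (p - n)) →
      (∀ q, q ∈ A ↔ ∃ s : ℝ, 0 ≤ s ∧ s ≤ 1 ∧ q = p + s • (n - p)) := by
    intro n p h q
    rw [h]
    constructor <;> rintro ⟨s, h0, h1, rfl⟩ <;>
      exact ⟨1 - s, by linarith, by linarith, by module⟩
  rcases hA with ⟨ε, k, hε, hk, hA⟩ | ⟨t, ht, hA⟩
  · have h := side ε k hA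
    rcases hε with rfl | rfl <;> rcases hk with rfl | rfl | rfl <;>
    first
      | (refine key _ _ ?_ ?_ h ?_
         · rw [mem_negVertices]; norm_num
         · rw [mem_posVertices]; norm_num
         · intro s h0 h1
           rw [mem_vertices, IsLevel]
           rintro ⟨-, h | h | h | h⟩ <;> simp at h <;> linarith)
      | (refine key _ _ ?_ ?_ (rev _ _ h) ?_
         · rw [mem_negVertices]; norm_num
         · rw [mem_posVertices]; norm_num
         · intro s h0 h1
           rw [mem_vertices, IsLevel]
           rintro ⟨-, h | h | h | h⟩ <;> simp at h <;> linarith)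
  · have h := level t hA
    rcases ht with rfl | rfl | rfl | rfl <;>
    first
      | (refine key _ _ ?_ ?_ h ?_
         · rw [mem_negVertices]; norm_num
         · rw [mem_posVertices]; norm_num
         · intro s h0 h1
           rw [mem_vertices]
           rintro ⟨h | h, -⟩ <;> norm_num at h <;> linarith)
      | (refine key _ _ ?_ ?_ (rev _ _ h) ?_
         · rw [mem_negVertices]; norm_num
         · rw [mem_posVertices]; norm_num
         · intro s h0 h1
           rw [mem_vertices]
           rintro ⟨h | h, -⟩ <;> norm_num at h <;> linarith)

/-- A path through arcs that joins a negative to a positive vertex, and meets no vertex in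
between, traverses a single arc. -/
lemma isArc_range {γ : C(unitInterval, ℝ × ℝ)} (h0 : γ 0 ∈ negVertices) (h1 : γ 1 ∈ posVertices)
    (hγ : ∀ s, s ≠ 0 → s ≠ 1 → γ s ∉ posVertices ∪ negVertices)
    (hg : ∀ s, ∃ A, IsArc A ∧ γ s ∈ A) : IsArc (Set.range γ) := by
  let m : unitInterval := ⟨1 / 2, by norm_num, by norm_num⟩
  have hm : m ∈ Set.Ioo (0 : unitInterval) 1 := by
    constructor <;> rw [← Subtype.coe_lt_coe] <;> norm_num [m]
  obtain ⟨A, hA, hmA⟩ := hg m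
  obtain ⟨U, hU, hAU⟩ := hA.exists_isOpen
  have hiff : ∀ s ∈ Set.Ioo (0 : unitInterval) 1, (γ s ∈ A ↔ γ s ∈ U) := fun s hs => by
    obtain ⟨B, hB, hsB⟩ := hg s
    exact hAU B hB _ hsB (hγ s hs.1.ne' hs.2.ne)
  -- Among points of arcs that are not vertices, `A` is relatively open and closed, so the connected
  -- open interval cannot leave it.
  have hIoo : Set.Ioo (0 : unitInterval) 1 ⊆ γ ⁻¹' A := by
    intro s hs
    by_contra hsA
    obtain ⟨r, hr, hrU, hrA⟩ := isPreconnected_Ioo (γ ⁻¹' U) (γ ⁻¹' Aᶜ) (hU.preimage γ.continuous)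
      (hA.isClosed.isOpen_compl.preimage γ.continuous)
      (fun r hr => by
        by_cases h : γ r ∈ A
        · exact .inl ((hiff r hr).1 h)
        · exact .inr h)
      ⟨m, hm, (hiff m hm).1 hmA⟩ ⟨s, hs, hsA⟩
    exact hrA ((hiff r hr).2 hrU)
  have hall : ∀ s, γ s ∈ A := by
    have := closure_minimal hIoo (hA.isClosed.preimage γ.continuous)
    rw [closure_Ioo zero_ne_one] at this
    exact fun s => this ⟨unitInterval.nonneg s, unitInterval.le_one s⟩
  -- The path joins two distinct vertices of `A`, hence its two endpoints, and the intermediate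
  -- value theorem fills in everything between.
  suffices A ⊆ Set.range γ by
    rwa [(Set.range_subset_iff.2 hall).antisymm this]
  have ivt : ∀ (f : ℝ × ℝ → ℝ), Continuous f → ∀ y,
      (f (γ 0) ≤ y ∧ y ≤ f (γ 1)) ∨ (f (γ 1) ≤ y ∧ y ≤ f (γ 0)) → ∃ s, f (γ s) = y := by
    intro f hf y hy
    have hc : Continuous fun s => f (γ s) := hf.comp γ.continuous
    rcases hy with hy | hy
    · exact intermediate_value_univ 0 1 hc hy
    · exact intermediate_value_univ 1 0 hc hy
  have hne : γ 0 ≠ γ 1 := fun h => Set.disjoint_left.1 disjoint_vertices h1 (h ▸ h0)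
  have hv0 := mem_vertices.1 (Set.mem_union_right posVertices h0)
  have hv1 := mem_vertices.1 (Set.mem_union_left negVertices h1)
  rcases hA with ⟨ε, k, hε, hk, rfl⟩ | ⟨t, ht, rfl⟩
  · rintro q ⟨hq1, hq2, hq3⟩
    obtain ⟨a1, a2, a3⟩ := hall 0
    obtain ⟨b1, b2, b3⟩ := hall 1
    have hne2 : (γ 0).2 ≠ (γ 1).2 := fun h => hne (Prod.ext (a1.trans b1.symm) h)
    obtain ⟨s, hs⟩ := ivt Prod.snd continuous_snd q.2 (by
      rcases hv0.2 with h | h | h | h <;> rcases hv1.2 with h' | h' | h' | h' <;>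
        rcases hk with rfl | rfl | rfl <;>
        first
          | exact absurd (h.trans h'.symm) hne2
          | (exfalso; linarith)
          | (left; constructor <;> linarith)
          | (right; constructor <;> linarith))
    exact ⟨s, Prod.ext ((hall s).1.trans hq1.symm) hs⟩
  · rintro q ⟨hq1, hq2, hq3⟩
    have hne1 : (γ 0).1 ≠ (γ 1).1 := fun h =>
      hne (Prod.ext h ((hall 0).2.2.trans (hall 1).2.2.symm))
    obtain ⟨s, hs⟩ := ivt Prod.fst continuous_fst q.1 (by
      rcases hv0.1 with h | h <;> rcases hv1.1 with h' | h' <;>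
        first
          | exact absurd (h.trans h'.symm) hne1
          | (left; constructor <;> linarith)
          | (right; constructor <;> linarith))
    exact ⟨s, Prod.ext hs ((hall s).2.2.trans hq3.symm)⟩

end Arcs

/-! ### Rectangles and their boundary charts -/

/-- A rectangle of width `[-1, 1]` whose bottom and top lie at the heights of vertices. -/
structure Slab where
  bot : ℝ
  top : ℝ
  bot_level : IsLevel bot
  top_level : IsLevel top
  lt : bot < top

namespace Slab

variable (L : Slab)

/-- The points of the slab. -/
def rect : Set (ℝ × ℝ) := {p | -1 ≤ p.1 ∧ p.1 ≤ 1 ∧ L.bot ≤ p.2 ∧ p.2 ≤ L.top}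

/-- The boundary. -/
def bd : Set L.rect := {x | x.1.1 = -1 ∨ x.1.1 = 1 ∨ x.1.2 = L.bot ∨ x.1.2 = L.top}

/-- The interior, as a subset of the plane. -/
def inside : Set (ℝ × ℝ) := {p | -1 < p.1 ∧ p.1 < 1 ∧ L.bot < p.2 ∧ p.2 < L.top}

/-- The positive vertices. -/
def Vpos : Set L.rect := {x | x.1 ∈ posVertices}

/-- The negative vertices. -/
def Vneg : Set L.rect := {x | x.1 ∈ negVertices}

lemma mem_rect_iff_Icc {p : ℝ × ℝ} : p ∈ L.rect ↔ p ∈ Set.Icc ((-1 : ℝ), L.bot) (1, L.top) := by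
  simp only [rect, Set.mem_ofPred_eq, Set.mem_Icc, Prod.le_def]
  tauto

lemma rect_eq_Icc : L.rect = Set.Icc ((-1 : ℝ), L.bot) (1, L.top) :=
  Set.ext fun _ => L.mem_rect_iff_Icc

lemma bounds : -3 ≤ L.bot ∧ L.top ≤ 3 := by
  constructor
  · rcases L.bot_level with h | h | h | h <;> linarith
  · rcases L.top_level with h | h | h | h <;> linarith

lemma notMem_bd {x : L.rect} : x ∉ L.bd ↔ x.1 ∈ L.inside := by
  obtain ⟨p, h1, h2, h3, h4⟩ := x
  simp only [bd, inside, Set.mem_ofPred_eq, not_or]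
  constructor
  · rintro ⟨a, b, c, d⟩
    exact ⟨lt_of_le_of_ne h1 (Ne.symm a), lt_of_le_of_ne h2 b, lt_of_le_of_ne h3 (Ne.symm c),
      lt_of_le_of_ne h4 d⟩
  · rintro ⟨a, b, c, d⟩
    exact ⟨a.ne', b.ne, c.ne', d.ne⟩

lemma isOpen_inside : IsOpen L.inside :=
  (isOpen_lt continuous_const continuous_fst).inter
    ((isOpen_lt continuous_fst continuous_const).inter
      ((isOpen_lt continuous_const continuous_snd).inter
        (isOpen_lt continuous_snd continuous_const)))

lemma inside_subset : L.inside ⊆ L.rect := fun _ h => ⟨h.1.le, h.2.1.le, h.2.2.1.le, h.2.2.2.le⟩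

/-- The nearest-point retraction of the plane onto a slab. -/
def clamp (p : ℝ × ℝ) : L.rect :=
  ⟨(max (-1) (min 1 p.1), max L.bot (min L.top p.2)), le_max_left _ _,
    max_le (by norm_num) (min_le_left _ _), le_max_left _ _, max_le L.lt.le (min_le_left _ _)⟩

lemma continuous_clamp : Continuous L.clamp := by
  unfold clamp
  fun_prop

lemma clamp_of_mem {p : ℝ × ℝ} (hp : p ∈ L.rect) : (L.clamp p).1 = p := by
  obtain ⟨h1, h2, h3, h4⟩ := hp
  simp [clamp, h1, h2, h3, h4]

/-- A homeomorphism of the plane that maps a slab to a half plane, within an open set, restricts to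
a chart of the slab. -/
lemma exists_halfChart (φ : (ℝ × ℝ) ≃ₜ (ℝ × ℝ)) {N : Set (ℝ × ℝ)} (hN : IsOpen N)
    (h : ∀ p ∈ N, p ∈ L.rect ↔ 0 ≤ (φ p).1) :
    ∃ e : OpenPartialHomeomorph L.rect (EuclideanHalfSpace 2), e.source = {x | x.1 ∈ N} ∧
      ∀ x ∈ e.source, (e x).val 0 = (φ x.1).1 ∧ (e x).val 1 = (φ x.1).2 := by
  -- Truncation by `max 0` makes the chart defined on all of the slab, just as `clamp` does for its
  -- inverse; both truncations are inert over `N`.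
  let f : L.rect → EuclideanHalfSpace 2 := fun x =>
    ⟨!₂[max 0 (φ x.1).1, (φ x.1).2], by simp⟩
  let g : EuclideanHalfSpace 2 → ℝ × ℝ := fun y => φ.symm (y.val 0, y.val 1)
  have hf : Continuous f := by
    refine Continuous.subtype_mk ?_ _
    have : Continuous fun x : L.rect => φ x.1 := φ.continuous.comp continuous_subtype_val
    fun_prop
  have hg : Continuous g := by
    refine φ.symm.continuous.comp ?_
    have : Continuous fun y : EuclideanHalfSpace 2 => y.val := continuous_subtype_val
    fun_prop
  have hf0 : ∀ x : L.rect, x.1 ∈ N → (f x).val 0 = (φ x.1).1 := fun x hx => by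
    simp [f, (h x.1 hx).1 x.2]
  have hf1 : ∀ x : L.rect, (f x).val 1 = (φ x.1).2 := fun x => by simp [f]
  have hgf : ∀ x : L.rect, x.1 ∈ N → g (f x) = x.1 := fun x hx => by
    simp only [g, hf0 x hx, hf1]
    exact φ.symm_apply_apply x.1
  have hgr : ∀ y, g y ∈ N → g y ∈ L.rect := fun y hy => by
    rw [h _ hy]
    simpa [g] using y.2
  refine ⟨{
    toFun := f
    invFun := fun y => L.clamp (g y)
    source := {x | x.1 ∈ N}
    target := {y | g y ∈ N}
    map_source' := fun x hx => by
      rw [Set.mem_ofPred_eq, hgf x hx]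
      exact hx
    map_target' := fun y hy => by
      rw [Set.mem_ofPred_eq, L.clamp_of_mem (hgr y hy)]
      exact hy
    left_inv' := fun x hx => by
      rw [hgf x hx]
      exact Subtype.ext (L.clamp_of_mem x.2)
    right_inv' := fun y hy => by
      have hc := L.clamp_of_mem (hgr y hy)
      have hm : (L.clamp (g y)).1 ∈ N := by
        rw [hc]
        exact hy
      refine Subtype.ext (PiLp.ext fun i => ?_)
      fin_cases i
      · refine (hf0 _ hm).trans ?_
        rw [hc]
        simp [g]
      · refine (hf1 _).trans ?_
        rw [hc]
        simp [g]
    continuousOn_toFun := hf.continuousOn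
    continuousOn_invFun := (L.continuous_clamp.comp hg).continuousOn
    open_source := hN.preimage continuous_subtype_val
    open_target := hN.preimage hg }, rfl, fun x hx => ⟨hf0 x hx, hf1 x⟩⟩

/-- A homeomorphism of the plane that folds a quadrant, with corner `(ε, c)`, to a half plane. -/
def foldQuadrant (ε δ c : ℝ) (hε : ε * ε = 1) (hδ : δ * δ = 1) : (ℝ × ℝ) ≃ₜ (ℝ × ℝ) where
  -- In terms of the signed distances `a`, `b` to the two sides, this is `(min a b, a - b)`: the
  -- first entry is nonnegative exactly on the quadrant, and on it vanishes exactly on the two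
  -- sides. The inverse recovers `a` and `b` by adding the positive and negative parts of `a - b`.
  toFun p := (min (1 - ε * p.1) (δ * (c - p.2)), (1 - ε * p.1) - δ * (c - p.2))
  invFun q := (ε * (1 - (q.1 + max q.2 0)), c - δ * (q.1 + max (-q.2) 0))
  left_inv p := by
    obtain ⟨x, y⟩ := p
    beta_reduce
    dsimp only
    rcases le_total (1 - ε * x) (δ * (c - y)) with h | h
    · rw [min_eq_left h, max_eq_right (by linarith), max_eq_left (by linarith)]
      exact Prod.ext (by linear_combination x * hε) (by linear_combination (y - c) * hδ)
    · rw [min_eq_right h, max_eq_left (by linarith), max_eq_right (by linarith)]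
      exact Prod.ext (by linear_combination x * hε) (by linear_combination (y - c) * hδ)
  right_inv q := by
    obtain ⟨x, y⟩ := q
    have h1 : ∀ r : ℝ, 1 - ε * (ε * (1 - r)) = r := fun r => by linear_combination (r - 1) * hε
    have h2 : ∀ r : ℝ, δ * (c - (c - δ * r)) = r := fun r => by linear_combination r * hδ
    simp only [h1, h2]
    rcases le_total y 0 with h | h
    · rw [max_eq_right h, max_eq_left (by linarith), min_eq_left (by linarith)]
      exact Prod.ext (by ring) (by ring)
    · rw [max_eq_left h, max_eq_right (by linarith), min_eq_right (by linarith)]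
      exact Prod.ext (by ring) (by ring)
  continuous_toFun := by fun_prop
  continuous_invFun := by fun_prop

/-- A folded quadrant serves interior points, edge points and corners alike: the open set only has
to avoid the two sides opposite to the chosen corner. -/
lemma exists_boundaryChart (x : L.rect) :
    ∃ e : OpenPartialHomeomorph L.rect (EuclideanHalfSpace 2),
      x ∈ e.source ∧ ∀ y ∈ e.source, y ∈ L.bd ↔ (e y).val 0 = 0 := by
  have key : ∀ ε δ c : ℝ, (ε = 1 ∨ ε = -1) → (δ = 1 ∧ c = L.top ∨ δ = -1 ∧ c = L.bot) →
      0 < 1 + ε * x.1.1 → 0 < (L.top - L.bot) - δ * (c - x.1.2) →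
      ∃ e : OpenPartialHomeomorph L.rect (EuclideanHalfSpace 2),
        x ∈ e.source ∧ ∀ y ∈ e.source, y ∈ L.bd ↔ (e y).val 0 = 0 := by
    intro ε δ c hε hδ h1 h2
    have hε' : ε * ε = 1 := by rcases hε with rfl | rfl <;> norm_num
    have hδ' : δ * δ = 1 := by rcases hδ with ⟨rfl, -⟩ | ⟨rfl, -⟩ <;> norm_num
    obtain ⟨e, he, he'⟩ := L.exists_halfChart (foldQuadrant ε δ c hε' hδ')
      (N := {p | 0 < 1 + ε * p.1 ∧ 0 < (L.top - L.bot) - δ * (c - p.2)})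
      (IsOpen.and (isOpen_lt continuous_const (by fun_prop))
        (isOpen_lt continuous_const (by fun_prop)))
      (by
        rintro p ⟨hp1, hp2⟩
        change _ ↔ 0 ≤ min _ _
        rw [le_min_iff]
        simp only [rect, Set.mem_ofPred_eq]
        rcases hε with rfl | rfl <;> rcases hδ with ⟨rfl, rfl⟩ | ⟨rfl, rfl⟩ <;> constructor <;>
          (intro h; refine ⟨?_, ?_⟩ <;> try refine ⟨?_, ?_, ?_⟩) <;>
          linarith [h.1, h.2])
    refine ⟨e, he ▸ ⟨h1, h2⟩, fun y hy => ?_⟩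
    rw [(he' y hy).1]
    change _ ↔ min _ _ = 0
    rw [he] at hy
    obtain ⟨hp1, hp2⟩ := hy
    obtain ⟨p, hp⟩ := y
    obtain ⟨b1, b2, b3, b4⟩ := hp
    simp only [bd, Set.mem_ofPred_eq] at *
    have hmin : ∀ u v : ℝ, 0 ≤ u → 0 ≤ v → (min u v = 0 ↔ u = 0 ∨ v = 0) := by
      intro u v hu hv
      rcases le_total u v with h | h
      · rw [min_eq_left h]
        exact ⟨.inl, fun h' => h'.elim id fun h' => by linarith⟩
      · rw [min_eq_right h]
        exact ⟨.inr, fun h' => h'.elim (fun h' => by linarith) id⟩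
    rcases hε with rfl | rfl <;> rcases hδ with ⟨rfl, rfl⟩ | ⟨rfl, rfl⟩ <;>
      rw [hmin _ _ (by linarith) (by linarith)] <;> constructor
    all_goals
      first
        | (rintro (h | h | h | h) <;>
            first
              | (left; linarith)
              | (right; linarith))
        | (rintro (h | h) <;>
            first
              | (left; linarith)
              | (right; left; linarith)
              | (right; right; left; linarith)
              | (right; right; right; linarith))
  obtain ⟨b1, b2, b3, b4⟩ := x.2
  have hL := L.lt
  rcases le_total 0 x.1.1 with hx | hx <;>
    rcases lt_or_ge L.bot x.1.2 with hy | hy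
  · exact key 1 1 L.top (.inl rfl) (.inl ⟨rfl, rfl⟩) (by linarith) (by linarith)
  · exact key 1 (-1) L.bot (.inl rfl) (.inr ⟨rfl, rfl⟩) (by linarith) (by linarith)
  · exact key (-1) 1 L.top (.inr rfl) (.inl ⟨rfl, rfl⟩) (by linarith) (by linarith)
  · exact key (-1) (-1) L.bot (.inr rfl) (.inr ⟨rfl, rfl⟩) (by linarith) (by linarith)

end Slab

/-! ### Planar coordinates and orientation -/

/-- The half width of the planar octagon `|x| ≤ 3`, `|y| ≤ 3`, `|x| + |y| ≤ 4` at a given height,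
continued by a positive constant. -/
def width (t : ℝ) : ℝ := max 1 (min 3 (4 - |t|))

lemma width_pos (t : ℝ) : 0 < width t := lt_of_lt_of_le one_pos (le_max_left _ _)

lemma continuous_width : Continuous width := by
  unfold width
  fun_prop

lemma width_neg (t : ℝ) : width (-t) = width t := by simp [width]

/-- The homeomorphism from rectangular coordinates to the complex plane that takes the rectangle
`[-1, 1] × [-3, 3]` to an octagon with a fourfold symmetry. -/
def planar : (ℝ × ℝ) ≃ₜ ℂ where
  toFun p := ⟨p.1 * width p.2, p.2⟩
  invFun z := (z.re / width z.im, z.im)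
  left_inv p := by simp [(width_pos p.2).ne']
  right_inv z := by simp [(width_pos z.im).ne']
  continuous_toFun := by
    have : (fun p : ℝ × ℝ => (⟨p.1 * width p.2, p.2⟩ : ℂ)) =
        fun p => ((p.1 * width p.2 : ℝ) : ℂ) + (p.2 : ℂ) * Complex.I := by
      ext p
      apply Complex.ext <;> simp
    rw [this]
    have := continuous_width
    fun_prop
  continuous_invFun := by
    refine (Complex.continuous_re.div (continuous_width.comp Complex.continuous_im) fun z =>
      (width_pos _).ne').prodMk Complex.continuous_im

namespace Slab

variable (L : Slab)

/-- The interior of a slab as a domain in the complex plane. -/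
def interiorChart : OpenPartialHomeomorph L.rect ℂ where
  toFun x := planar x.1
  invFun z := L.clamp (planar.symm z)
  source := L.bdᶜ
  target := {z | planar.symm z ∈ L.inside}
  map_source' x hx := by
    simpa using L.notMem_bd.1 hx
  map_target' z hz := by
    rw [Set.mem_compl_iff, L.notMem_bd, L.clamp_of_mem (L.inside_subset hz)]
    exact hz
  left_inv' x hx := by
    rw [planar.symm_apply_apply]
    exact Subtype.ext (L.clamp_of_mem x.2)
  right_inv' z hz := by
    rw [L.clamp_of_mem (L.inside_subset hz), planar.apply_symm_apply]
  continuousOn_toFun := (planar.continuous.comp continuous_subtype_val).continuousOn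
  continuousOn_invFun := (L.continuous_clamp.comp planar.symm.continuous).continuousOn
  open_source := by
    have : L.bdᶜ = Subtype.val ⁻¹' L.inside := Set.ext fun x => L.notMem_bd
    rw [this]
    exact L.isOpen_inside.preimage continuous_subtype_val
  open_target := L.isOpen_inside.preimage planar.symm.continuous

end Slab

/-- A map that is locally multiplication by a constant preserves orientation. -/
lemma preservesOrientationAt_of_eventuallyEq {f : ℂ → ℂ} {z c : ℂ} (hc : c ≠ 0)
    (hf : ∀ᶠ w in 𝓝 z, f w = c * w) : PreservesOrientationAt f z := by
  obtain ⟨ε, hε, h⟩ := Metric.eventually_nhds_iff.1 hf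
  filter_upwards [Ioo_mem_nhdsGT hε] with r hr
  -- The circle of radius `r` goes to a circle of radius `r * ‖c‖`, with all angles shifted by
  -- `c.arg`.
  refine ⟨fun t => t + c.arg, by fun_prop, fun t => ⟨r * ‖c‖, ?_, ?_⟩, by ring⟩
  · exact mul_pos hr.1 (norm_pos_iff.2 hc)
  · rw [h (by simp [Complex.norm_exp_ofReal_mul_I, abs_of_pos hr.1, hr.2]), hf.self_of_nhds]
    have := Complex.norm_mul_exp_arg_mul_I c
    push_cast
    rw [add_mul, Complex.exp_add]
    linear_combination (-(r * Complex.exp (t * Complex.I))) * this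

/-! ### Rectangles as occupied surfaces -/

namespace Slab

variable (L : Slab)

/-- Every boundary point lies on an arc in the boundary. -/
lemma exists_arc {x : L.rect} (hx : x ∈ L.bd) :
    ∃ A, IsArc A ∧ x.1 ∈ A ∧ ∀ q ∈ A, ∃ h : q ∈ L.rect, (⟨q, h⟩ : L.rect) ∈ L.bd := by
  obtain ⟨⟨u, t⟩, h1, h2, h3, h4⟩ := x
  have hL := L.lt
  have level : ∀ t', t' = L.bot ∨ t' = L.top → t = t' →
      ∃ A, IsArc A ∧ (u, t) ∈ A ∧ ∀ q ∈ A, ∃ h : q ∈ L.rect, (⟨q, h⟩ : L.rect) ∈ L.bd := by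
    rintro t' ht' rfl
    refine ⟨levelArc t, .inr ⟨t, ?_, rfl⟩, ⟨h1, h2, rfl⟩, ?_⟩
    · rcases ht' with h | h
      · exact h ▸ L.bot_level
      · exact h ▸ L.top_level
    · rintro q ⟨h5, h6, h7⟩
      refine ⟨⟨h5, h6, h7 ▸ h3, h7 ▸ h4⟩, ?_⟩
      rcases ht' with h | h
      · exact .inr (.inr (.inl (h7.trans h)))
      · exact .inr (.inr (.inr (h7.trans h)))
  have side : ∀ ε, (ε = 1 ∨ ε = -1) → u = ε → L.bot < t → t < L.top →
      ∃ A, IsArc A ∧ (u, t) ∈ A ∧ ∀ q ∈ A, ∃ h : q ∈ L.rect, (⟨q, h⟩ : L.rect) ∈ L.bd := by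
    rintro ε hε rfl hb ht
    -- The unit between consecutive levels that contains `t` stays within the slab because `bot` and
    -- `top` are themselves levels.
    have : ∃ k : ℝ, (k = -3 ∨ k = -1 ∨ k = 1) ∧ L.bot ≤ k ∧ k + 2 ≤ L.top ∧ k ≤ t ∧ t ≤ k + 2 := by
      rcases L.bot_level with hb' | hb' | hb' | hb' <;>
      rcases L.top_level with ht' | ht' | ht' | ht' <;>
      rcases le_total t (-1) with h5 | h5 <;> rcases le_total t 1 with h6 | h6 <;>
      rw [hb'] at hb hL ⊢ <;> rw [ht'] at ht hL ⊢ <;>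
      first
        | (exfalso; linarith)
        | exact ⟨-3, .inl rfl, by linarith, by linarith, by linarith, by linarith⟩
        | exact ⟨-1, .inr (.inl rfl), by linarith, by linarith, by linarith, by linarith⟩
        | exact ⟨1, .inr (.inr rfl), by linarith, by linarith, by linarith, by linarith⟩
    obtain ⟨k, hk, hk1, hk2, hk3, hk4⟩ := this
    refine ⟨sideArc u k, .inl ⟨u, k, hε, hk, rfl⟩, ⟨rfl, hk3, hk4⟩, ?_⟩
    rintro q ⟨h5, h6, h7⟩
    refine ⟨⟨h5 ▸ h1, h5 ▸ h2, hk1.trans h6, h7.trans hk2⟩, ?_⟩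
    rcases hε with h | h
    · exact .inr (.inl (h5.trans h))
    · exact .inl (h5.trans h)
  rcases h3.eq_or_lt with h | h3
  · exact level L.bot (.inl rfl) h.symm
  rcases h4.eq_or_lt with h | h4
  · exact level L.top (.inr rfl) h
  rcases hx with h | h | h | h
  · exact side (-1) (.inr rfl) h h3 h4
  · exact side 1 (.inl rfl) h h3 h4
  · exact level L.bot (.inl rfl) h
  · exact level L.top (.inr rfl) h

/-- The boundary edges of a slab are the arcs in its boundary. -/
lemma isBoundaryEdge_iff {E : Set L.rect} :
    IsBoundaryEdge L.bd L.Vpos L.Vneg E ↔ IsArc (Subtype.val '' E) ∧ E ⊆ L.bd := by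
  constructor
  · rintro ⟨γ, hinj, hr, hE, h0, h1, hint⟩
    refine ⟨?_, hE⟩
    let γ' : C(unitInterval, ℝ × ℝ) := ⟨fun s => (γ s).1, by fun_prop⟩
    have : Subtype.val '' E = Set.range γ' := by
      rw [← hr, ← Set.range_comp]
      rfl
    rw [this]
    refine isArc_range (γ := γ') h0 h1 (fun s hs0 hs1 => hint s hs0 hs1) fun s => ?_
    obtain ⟨A, hA, hsA, -⟩ := L.exists_arc (hE (hr ▸ ⟨s, rfl⟩ : γ s ∈ E))
    exact ⟨A, hA, hsA⟩
  · rintro ⟨hA, hE⟩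
    obtain ⟨γ, hinj, hr, h0, h1, hint⟩ := hA.exists_path
    have hmem : ∀ s, ∃ x ∈ E, x.1 = γ s := fun s => by
      have : γ s ∈ Subtype.val '' E := hr ▸ ⟨s, rfl⟩
      exact this
    have hrect : ∀ s, γ s ∈ L.rect := fun s => by
      obtain ⟨x, -, hx⟩ := hmem s
      exact hx ▸ x.2
    refine ⟨⟨fun s => ⟨γ s, hrect s⟩, by fun_prop⟩, fun s s' h => hinj (congrArg Subtype.val h),
      ?_, hE, h0, h1, hint⟩
    ext x
    constructor
    · rintro ⟨s, rfl⟩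
      obtain ⟨y, hy, hys⟩ := hmem s
      rwa [show y = ⟨γ s, hrect s⟩ from Subtype.ext hys] at hy
    · intro hx
      have : x.1 ∈ Set.range γ := hr ▸ ⟨x, hx, rfl⟩
      obtain ⟨s, hs⟩ := this
      exact ⟨s, Subtype.ext hs⟩

lemma finite_vertices : posVertices.Finite ∧ negVertices.Finite := by
  constructor
  · exact Set.toFinite {(1, 1), (-1, 3), (-1, -1), (1, -3)}
  · exact Set.toFinite {(-1, 1), (1, 3), (1, -1), (-1, -3)}

lemma vertex_mem_bd {x : L.rect} (hx : x.1 ∈ posVertices ∪ negVertices) : x ∈ L.bd := by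
  rcases (mem_vertices.1 hx).1 with h | h
  · exact .inr (.inl h)
  · exact .inl h

instance : CompactSpace L.rect := by
  rw [← isCompact_iff_compactSpace, L.rect_eq_Icc]
  exact isCompact_Icc

instance : PreconnectedSpace L.rect := by
  refine Subtype.preconnectedSpace (Convex.isPreconnected ?_)
  rw [L.rect_eq_Icc]
  exact convex_Icc _ _

/-- A slab as an occupied surface. -/
def surface : OccupiedSurface where
  carrier := L.rect
  bd := L.bd
  exists_chart := L.exists_boundaryChart
  -- The only chart passes through `planar`, so turns of the octagon become multiplications by
  -- constants in charts.
  atlas := {L.interiorChart}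
  atlas_interior := by
    rintro e rfl
    exact subset_rfl
  atlas_cover x hx := ⟨_, rfl, hx⟩
  atlas_compatible := by
    rintro e rfl e' rfl x hx -
    refine preservesOrientationAt_of_eventuallyEq one_ne_zero ?_
    filter_upwards [L.interiorChart.open_target.mem_nhds (L.interiorChart.map_source hx)] with w hw
    rw [one_mul, L.interiorChart.right_inv hw]
  Vpos := L.Vpos
  Vneg := L.Vneg
  Vpos_finite := finite_vertices.1.preimage Subtype.val_injective.injOn
  Vneg_finite := finite_vertices.2.preimage Subtype.val_injective.injOn
  Vpos_subset x hx := L.vertex_mem_bd (.inl hx)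
  Vneg_subset x hx := L.vertex_mem_bd (.inr hx)
  V_disjoint := disjoint_vertices.preimage _
  component_bd x := by
    rw [PreconnectedSpace.connectedComponent_eq_univ, Set.univ_inter]
    exact ⟨⟨(1, L.bot), by norm_num, le_rfl, le_rfl, L.lt.le⟩, .inr (.inl rfl)⟩
  edge_cover x hx _ := by
    obtain ⟨A, hA, hxA, h⟩ := L.exists_arc hx
    refine ⟨Subtype.val ⁻¹' A, L.isBoundaryEdge_iff.2 ⟨?_, fun y hy => (h _ hy).2⟩, hxA⟩
    rwa [Set.image_preimage_eq_of_subset fun q hq => ⟨⟨q, (h q hq).1⟩, rfl⟩]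

lemma mem_edges_iff {E : Set L.surface} :
    E ∈ L.surface.edges ↔ IsArc (Subtype.val '' E) ∧ E ⊆ L.bd := L.isBoundaryEdge_iff

/-- The interior is open in the plane and `φ` is a homeomorphism of the plane, so the image is the
trace on the target of an open set of the plane. -/
lemma isOpenEmbedding_restrict {L M : Slab} {f : L.surface → M.surface} (hf : Continuous f)
    (φ : (ℝ × ℝ) ≃ₜ (ℝ × ℝ)) (hφ : ∀ x, (f x).1 = φ x.1) :
    Topology.IsOpenEmbedding fun x : (L.surface.bdᶜ : Set L.surface) => f x := by
  have hind : Topology.IsEmbedding fun x : (L.surface.bdᶜ : Set L.surface) => f x := by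
    have h1 : Topology.IsEmbedding fun x : (L.surface.bdᶜ : Set L.surface) => φ x.1.1 :=
      φ.isEmbedding.comp (Topology.IsEmbedding.subtypeVal.comp Topology.IsEmbedding.subtypeVal)
    have h2 : (fun x : (L.surface.bdᶜ : Set L.surface) => φ x.1.1) =
        Subtype.val ∘ fun x : (L.surface.bdᶜ : Set L.surface) => f x :=
      funext fun x => (hφ x.1).symm
    rw [h2] at h1
    exact Topology.IsEmbedding.of_comp (hf.comp continuous_subtype_val) continuous_subtype_val h1
  refine ⟨hind, ?_⟩
  have : Set.range (fun x : (L.surface.bdᶜ : Set L.surface) => f x) =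
      Subtype.val ⁻¹' (φ.symm ⁻¹' L.inside) := by
    ext y
    constructor
    · rintro ⟨x, rfl⟩
      have := L.notMem_bd.1 x.2
      change φ.symm (f x.1).1 ∈ L.inside
      rw [hφ, φ.symm_apply_apply]
      exact this
    · intro hy
      let x : L.rect := ⟨_, L.inside_subset hy⟩
      exact ⟨⟨x, L.notMem_bd.2 hy⟩, Subtype.ext ((hφ x).trans (φ.apply_symm_apply y.1))⟩
  rw [this]
  exact (L.isOpen_inside.preimage φ.symm.continuous).preimage continuous_subtype_val

end Slab

/-! ### Sutures as zero sets of a triangle wave -/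

/-- A triangle wave, with zeros at `±1` and `±3`. -/
def zigzag (d : ℝ) : ℝ := |(|d| - 2)| - 1

lemma continuous_zigzag : Continuous zigzag := by
  unfold zigzag
  fun_prop

lemma zigzag_eq_zero {d : ℝ} : zigzag d = 0 ↔ d = 1 ∨ d = -1 ∨ d = 3 ∨ d = -3 := by
  unfold zigzag
  constructor
  · intro h
    rcases abs_cases d with ⟨h1, h2⟩ | ⟨h1, h2⟩ <;> rw [h1] at h
    · rcases abs_cases (d - 2) with ⟨h3, h4⟩ | ⟨h3, h4⟩ <;> rw [h3] at h
      · exact .inr (.inr (.inl (by linarith)))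
      · exact .inl (by linarith)
    · rcases abs_cases (-d - 2) with ⟨h3, h4⟩ | ⟨h3, h4⟩ <;> rw [h3] at h
      · exact .inr (.inr (.inr (by linarith)))
      · exact .inr (.inl (by linarith))
  · rintro (rfl | rfl | rfl | rfl) <;> norm_num

/-- Near a zero, the triangle wave has slope `1` or `-1`. -/
lemma zigzag_near {z : ℝ} (hz : zigzag z = 0) :
    ∃ κ : ℝ, κ * κ = 1 ∧ ∀ d, |d - z| < 1 → zigzag d = κ * (d - z) := by
  rcases zigzag_eq_zero.1 hz with rfl | rfl | rfl | rfl
  · refine ⟨-1, by norm_num, fun d hd => ?_⟩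
    rw [abs_lt] at hd
    rw [zigzag, abs_of_nonneg (a := d) (by linarith), abs_of_nonpos (by linarith)]
    ring
  · refine ⟨1, by norm_num, fun d hd => ?_⟩
    rw [abs_lt] at hd
    rw [zigzag, abs_of_nonpos (a := d) (by linarith), abs_of_nonpos (by linarith)]
    ring
  · refine ⟨1, by norm_num, fun d hd => ?_⟩
    rw [abs_lt] at hd
    rw [zigzag, abs_of_nonneg (a := d) (by linarith), abs_of_nonneg (by linarith)]
    ring
  · refine ⟨-1, by norm_num, fun d hd => ?_⟩
    rw [abs_lt] at hd
    rw [zigzag, abs_of_nonpos (a := d) (by linarith), abs_of_nonneg (by linarith)]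
    ring

/-- The data describing a system of curves, the zeros of a function `η * zigzag (δ * u + g t)`,
which meets each arc once. -/
structure SuturePattern where
  η : ℝ
  δ : ℝ
  g : ℝ → ℝ
  η_sq : η * η = 1
  δ_sq : δ * δ = 1
  continuous_g : Continuous g
  pos_vertex : ∀ q ∈ posVertices, 0 < η * zigzag (δ * q.1 + g q.2)
  neg_vertex : ∀ q ∈ negVertices, η * zigzag (δ * q.1 + g q.2) < 0
  arc_unique : ∀ A, IsArc A → ∃! q, q ∈ A ∧ zigzag (δ * q.1 + g q.2) = 0
  -- Where a curve exits through a vertical side, side and curve must be straightened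
  -- simultaneously, which requires solving for the height; slope `±1` allows this. Elsewhere the
  -- horizontal coordinate is solved for, and continuity of `g` suffices.
  side_affine : ∀ u t, (u = 1 ∨ u = -1) → -3 ≤ t → t ≤ 3 → zigzag (δ * u + g t) = 0 →
    ¬ IsLevel t ∧ ∃ σ c : ℝ, σ * σ = 1 ∧ ∀ᶠ s in 𝓝 t, g s = σ * s + c

/-- The homeomorphism of the plane that straightens a graph over the second coordinate. -/
def straightenGraph (c₀ c₁ κ δ z : ℝ) (g : ℝ → ℝ) (hg : Continuous g) (h₁ : c₁ * c₁ = 1)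
    (hκ : κ * κ = 1) (hδ : δ * δ = 1) : (ℝ × ℝ) ≃ₜ (ℝ × ℝ) where
  toFun p := (c₁ * (p.2 - c₀), κ * (δ * p.1 + g p.2 - z))
  invFun q := (δ * (κ * q.2 + z - g (c₁ * q.1 + c₀)), c₁ * q.1 + c₀)
  left_inv p := by
    have : c₁ * (c₁ * (p.2 - c₀)) + c₀ = p.2 := by linear_combination (p.2 - c₀) * h₁
    dsimp only
    rw [this]
    exact Prod.ext (by linear_combination (δ * (δ * p.1 + g p.2 - z)) * hκ + p.1 * hδ) rfl
  right_inv q := by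
    dsimp only
    exact Prod.ext (by linear_combination q.1 * h₁)
      (by linear_combination q.2 * hκ + κ * (κ * q.2 + z - g (c₁ * q.1 + c₀)) * hδ)
  continuous_toFun := by fun_prop
  continuous_invFun := by fun_prop

/-- The homeomorphism of the plane that straightens a line. -/
def straightenLine (ε κ δ σ z : ℝ) (hε : ε * ε = 1) (hκ : κ * κ = 1) (hσ : σ * σ = 1) :
    (ℝ × ℝ) ≃ₜ (ℝ × ℝ) where
  toFun p := (1 - ε * p.1, κ * (δ * p.1 + σ * p.2 - z))
  invFun q := (ε * (1 - q.1), σ * (κ * q.2 + z - δ * (ε * (1 - q.1))))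
  left_inv p := by
    have : ε * (1 - (1 - ε * p.1)) = p.1 := by linear_combination p.1 * hε
    dsimp only
    rw [this]
    exact Prod.ext rfl (by linear_combination (σ * (δ * p.1 + σ * p.2 - z)) * hκ + p.2 * hσ)
  right_inv q := by
    dsimp only
    exact Prod.ext (by linear_combination (q.1 - 1) * hε)
      (by linear_combination q.2 * hκ + κ * (κ * q.2 + z - δ * (ε * (1 - q.1))) * hσ)
  continuous_toFun := by fun_prop
  continuous_invFun := by fun_prop

namespace SuturePattern

variable (P : SuturePattern)

/-- The function whose sign determines the regions. -/
def fn (p : ℝ × ℝ) : ℝ := P.η * zigzag (P.δ * p.1 + P.g p.2)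

lemma continuous_phase : Continuous fun p : ℝ × ℝ => P.δ * p.1 + P.g p.2 := by
  have := P.continuous_g
  fun_prop

lemma continuous_fn : Continuous P.fn :=
  continuous_const.mul (continuous_zigzag.comp P.continuous_phase)

lemma fn_eq_zero {p : ℝ × ℝ} : P.fn p = 0 ↔ zigzag (P.δ * p.1 + P.g p.2) = 0 := by
  have : P.η ≠ 0 := fun h => by simpa [h] using P.η_sq
  simp [fn, this]

/-- The triangle wave has slope `±1` at its zeros and `η` is a sign, so up to sign the phase itself
is a local defining function of the curve. -/
lemma fn_near {p : ℝ × ℝ} (hp : P.fn p = 0) : ∃ κ : ℝ, κ * κ = 1 ∧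
    ∀ q : ℝ × ℝ, |P.δ * q.1 + P.g q.2 - (P.δ * p.1 + P.g p.2)| < 1 →
      P.fn q = κ * (P.δ * q.1 + P.g q.2 - (P.δ * p.1 + P.g p.2)) := by
  obtain ⟨κ, hκ, h⟩ := zigzag_near (P.fn_eq_zero.1 hp)
  refine ⟨P.η * κ, by rw [mul_mul_mul_comm, P.η_sq, hκ, one_mul], fun q hq => ?_⟩
  rw [fn, h _ hq, mul_assoc]

/-- At each zero, a slab has a chart in which the curve is straight. -/
lemma exists_chart (L : Slab) (x : L.rect) (hx : P.fn x.1 = 0) :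
    ∃ e : OpenPartialHomeomorph L.rect (EuclideanHalfSpace 2),
      x ∈ e.source ∧ ∀ y ∈ e.source, (y ∈ L.bd ↔ (e y).val 0 = 0) ∧
        (0 < P.fn y.1 ↔ 0 < (e y).val 1) ∧ (P.fn y.1 < 0 ↔ (e y).val 1 < 0) := by
  obtain ⟨κ, hκ, hnear⟩ := P.fn_near hx
  set z := P.δ * x.1.1 + P.g x.1.2 with hz
  have hopen : IsOpen {q : ℝ × ℝ | |P.δ * q.1 + P.g q.2 - z| < 1} :=
    isOpen_lt (continuous_abs.comp (P.continuous_phase.sub continuous_const)) continuous_const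
  obtain ⟨b1, b2, b3, b4⟩ := x.2
  have hL := L.lt
  -- Off the vertical sides the curve is a graph over the height; the first chart coordinate is the
  -- distance to the bottom or to the top.
  have graph : ∀ c₀ c₁ : ℝ, (c₁ = 1 ∧ c₀ = L.bot ∨ c₁ = -1 ∧ c₀ = L.top) → -1 < x.1.1 → x.1.1 < 1 →
      c₁ * (x.1.2 - c₀) < L.top - L.bot →
      ∃ e : OpenPartialHomeomorph L.rect (EuclideanHalfSpace 2),
        x ∈ e.source ∧ ∀ y ∈ e.source, (y ∈ L.bd ↔ (e y).val 0 = 0) ∧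
          (0 < P.fn y.1 ↔ 0 < (e y).val 1) ∧ (P.fn y.1 < 0 ↔ (e y).val 1 < 0) := by
    intro c₀ c₁ hc h1 h2 h3
    have hc' : c₁ * c₁ = 1 := by rcases hc with ⟨rfl, -⟩ | ⟨rfl, -⟩ <;> norm_num
    obtain ⟨e, he, he'⟩ := L.exists_halfChart
      (straightenGraph c₀ c₁ κ P.δ z P.g P.continuous_g hc' hκ P.δ_sq)
      (N := {q | -1 < q.1 ∧ q.1 < 1 ∧ c₁ * (q.2 - c₀) < L.top - L.bot ∧
        |P.δ * q.1 + P.g q.2 - z| < 1})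
      (IsOpen.and (isOpen_lt continuous_const (by fun_prop))
        (IsOpen.and (isOpen_lt (by fun_prop) continuous_const)
        (IsOpen.and (isOpen_lt (by fun_prop) continuous_const) hopen)))
      (by
        rintro p ⟨hp1, hp2, hp3, -⟩
        change _ ↔ 0 ≤ c₁ * (p.2 - c₀)
        simp only [Slab.rect, Set.mem_ofPred_eq]
        rcases hc with ⟨rfl, rfl⟩ | ⟨rfl, rfl⟩ <;> constructor
        · rintro ⟨-, -, h, h'⟩; linarith
        · exact fun h => ⟨by linarith, by linarith, by linarith, by linarith⟩
        · rintro ⟨-, -, h, h'⟩; linarith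
        · exact fun h => ⟨by linarith, by linarith, by linarith, by linarith⟩)
    refine ⟨e, he ▸ ⟨h1, h2, h3, by simp [← hz]⟩, fun y hy => ?_⟩
    rw [(he' y hy).1, (he' y hy).2]
    rw [he] at hy
    obtain ⟨hp1, hp2, hp3, hp4⟩ := hy
    rw [hnear _ hp4]
    refine ⟨?_, Iff.rfl, Iff.rfl⟩
    change _ ↔ c₁ * (y.1.2 - c₀) = 0
    simp only [Slab.bd, Set.mem_ofPred_eq]
    rcases hc with ⟨rfl, rfl⟩ | ⟨rfl, rfl⟩ <;> constructor
    · rintro (h | h | h | h) <;> linarith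
    · exact fun h => .inr (.inr (.inl (by linarith)))
    · rintro (h | h | h | h) <;> linarith
    · exact fun h => .inr (.inr (.inr (by linarith)))
  have line : ∀ ε : ℝ, (ε = 1 ∨ ε = -1) → x.1.1 = ε →
      ∃ e : OpenPartialHomeomorph L.rect (EuclideanHalfSpace 2),
        x ∈ e.source ∧ ∀ y ∈ e.source, (y ∈ L.bd ↔ (e y).val 0 = 0) ∧
          (0 < P.fn y.1 ↔ 0 < (e y).val 1) ∧ (P.fn y.1 < 0 ↔ (e y).val 1 < 0) := by
    intro ε hε hxε
    have hε' : ε * ε = 1 := by rcases hε with rfl | rfl <;> norm_num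
    obtain ⟨hlevel, σ, c, hσ, hev⟩ := P.side_affine x.1.1 x.1.2 (hxε ▸ hε)
      (L.bounds.1.trans b3) (b4.trans L.bounds.2) (P.fn_eq_zero.1 hx)
    obtain ⟨U, hUsub, hU, hxU⟩ := mem_nhds_iff.1 hev
    -- Curves never cross a vertical side at the height of a vertex, so the point is not a corner.
    have h3 : L.bot < x.1.2 := lt_of_le_of_ne b3 fun h => hlevel (h ▸ L.bot_level)
    have h4 : x.1.2 < L.top := lt_of_le_of_ne b4 fun h => hlevel (h ▸ L.top_level)
    obtain ⟨e, he, he'⟩ := L.exists_halfChart (straightenLine ε κ P.δ σ (z - c) hε' hκ hσ)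
      (N := {q | 0 < 1 + ε * q.1 ∧ L.bot < q.2 ∧ q.2 < L.top ∧ q.2 ∈ U ∧
        |P.δ * q.1 + P.g q.2 - z| < 1})
      (IsOpen.and (isOpen_lt continuous_const (by fun_prop))
        (IsOpen.and (isOpen_lt continuous_const (by fun_prop))
        (IsOpen.and (isOpen_lt (by fun_prop) continuous_const)
        (IsOpen.and (hU.preimage continuous_snd) hopen))))
      (by
        rintro p ⟨hp1, hp2, hp3, -⟩
        change _ ↔ 0 ≤ 1 - ε * p.1
        simp only [Slab.rect, Set.mem_ofPred_eq]
        rcases hε with rfl | rfl <;> constructor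
        · rintro ⟨h, h', -⟩; linarith
        · exact fun h => ⟨by linarith, by linarith, by linarith, by linarith⟩
        · rintro ⟨h, h', -⟩; linarith
        · exact fun h => ⟨by linarith, by linarith, by linarith, by linarith⟩)
    refine ⟨e, he ▸ ⟨?_, h3, h4, hxU, by simp [← hz]⟩, fun y hy => ?_⟩
    · rw [hxε, hε']; norm_num
    rw [(he' y hy).1, (he' y hy).2]
    rw [he] at hy
    obtain ⟨hp1, hp2, hp3, hp4, hp5⟩ := hy
    have h2 : (straightenLine ε κ P.δ σ (z - c) hε' hκ hσ y.1).2 = P.fn y.1 := by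
      have hgy : P.g y.1.2 = σ * y.1.2 + c := hUsub hp4
      rw [hnear _ hp5, hgy]
      change κ * (P.δ * y.1.1 + σ * y.1.2 - (z - c)) = _
      ring
    rw [h2]
    refine ⟨?_, Iff.rfl, Iff.rfl⟩
    change _ ↔ 1 - ε * y.1.1 = 0
    simp only [Slab.bd, Set.mem_ofPred_eq]
    rcases hε with rfl | rfl <;> constructor
    · rintro (h | h | h | h) <;> linarith
    · exact fun h => .inr (.inl (by linarith))
    · rintro (h | h | h | h) <;> linarith
    · exact fun h => .inl (by linarith)
  rcases b1.eq_or_lt with h | h1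
  · exact line (-1) (.inr rfl) h.symm
  rcases b2.eq_or_lt with h | h2
  · exact line 1 (.inl rfl) h
  rcases lt_or_ge x.1.2 L.top with h | h
  · exact graph L.bot 1 (.inl ⟨rfl, rfl⟩) h1 h2 (by linarith)
  · exact graph L.top (-1) (.inr ⟨rfl, rfl⟩) h1 h2 (by linarith)

/-- The sutures with a given pattern on a slab. -/
def sutures (L : Slab) : Sutures L.surface where
  pos := {x : L.rect | 0 < P.fn x.1}
  neg := {x : L.rect | P.fn x.1 < 0}
  isOpen_pos := isOpen_lt continuous_const (P.continuous_fn.comp continuous_subtype_val)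
  isOpen_neg := isOpen_lt (P.continuous_fn.comp continuous_subtype_val) continuous_const
  disjoint := Set.disjoint_left.2 fun x (h : 0 < P.fn x.1) (h' : P.fn x.1 < 0) =>
    lt_asymm h h'
  Vpos_subset x hx := P.pos_vertex x.1 hx
  Vneg_subset x hx := P.neg_vertex x.1 hx
  exists_chart x hx := P.exists_chart L x
    (le_antisymm (not_lt.1 fun h => hx (.inl h)) (not_lt.1 fun h => hx (.inr h)))
  edge_unique E hE := by
    obtain ⟨q, ⟨⟨x, hxE, rfl⟩, hx⟩, huniq⟩ := P.arc_unique _ (L.mem_edges_iff.1 hE).1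
    rw [← P.fn_eq_zero] at hx
    refine ⟨x, ⟨hxE, fun h => h.elim (fun h => h.ne' hx) fun h => h.ne hx⟩, fun y hy => ?_⟩
    refine Subtype.ext (huniq y.1 ⟨⟨y, hy.1, rfl⟩, P.fn_eq_zero.1 ?_⟩)
    exact le_antisymm (not_lt.1 fun h => hy.2 (.inl h)) (not_lt.1 fun h => hy.2 (.inr h))

end SuturePattern

/-- A criterion for a system of curves to meet each arc once, at its midpoint. -/
lemma existsUnique_zero_of_isArc {d : ℝ × ℝ → ℝ}
    (hside : ∀ ε k t : ℝ, (ε = 1 ∨ ε = -1) → (k = -3 ∨ k = -1 ∨ k = 1) → k ≤ t → t ≤ k + 2 →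
      (zigzag (d (ε, t)) = 0 ↔ t = k + 1))
    (hlevel : ∀ u t : ℝ, IsLevel t → -1 ≤ u → u ≤ 1 → (zigzag (d (u, t)) = 0 ↔ u = 0))
    (A : Set (ℝ × ℝ)) (hA : IsArc A) : ∃! q, q ∈ A ∧ zigzag (d q) = 0 := by
  rcases hA with ⟨ε, k, hε, hk, rfl⟩ | ⟨t, ht, rfl⟩
  · refine ⟨(ε, k + 1), ⟨⟨rfl, by simp, ?_⟩, ?_⟩, ?_⟩
    · change k + 1 ≤ k + 2
      linarith
    · exact (hside ε k (k + 1) hε hk (by linarith) (by linarith)).2 rfl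
    · rintro ⟨u, t⟩ ⟨⟨rfl, h1, h2⟩, h⟩
      exact Prod.ext rfl ((hside u k t hε hk h1 h2).1 h)
  · refine ⟨(0, t), ⟨⟨by norm_num, by norm_num, rfl⟩, ?_⟩, ?_⟩
    · exact (hlevel 0 t ht (by norm_num) (by norm_num)).2 rfl
    · rintro ⟨u, s⟩ ⟨⟨h1, h2, rfl⟩, h⟩
      exact Prod.ext ((hlevel u s ht h1 h2).1 h) rfl

/-- A system of straight curves. -/
def straightPattern : SuturePattern where
  η := -1
  δ := 1
  g t := t
  η_sq := by norm_num
  δ_sq := by norm_num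
  continuous_g := continuous_id
  pos_vertex q hq := by
    rcases mem_posVertices.1 hq with ⟨h, h'⟩ | ⟨h, h'⟩ | ⟨h, h'⟩ | ⟨h, h'⟩ <;>
      rw [h, h'] <;> norm_num [zigzag]
  neg_vertex q hq := by
    rcases mem_negVertices.1 hq with ⟨h, h'⟩ | ⟨h, h'⟩ | ⟨h, h'⟩ | ⟨h, h'⟩ <;>
      rw [h, h'] <;> norm_num [zigzag]
  arc_unique := by
    refine existsUnique_zero_of_isArc (d := fun q => 1 * q.1 + q.2) ?_ ?_
    · intro ε k t hε hk h1 h2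
      rw [zigzag_eq_zero]
      rcases hε with rfl | rfl <;> rcases hk with rfl | rfl | rfl <;> constructor
      all_goals
        first
          | (rintro (h | h | h | h) <;> dsimp only at h <;> linarith)
          | (rintro rfl; norm_num)
    · intro u t ht h1 h2
      rw [zigzag_eq_zero]
      rcases ht with rfl | rfl | rfl | rfl <;> constructor
      all_goals
        first
          | (rintro (h | h | h | h) <;> dsimp only at h <;> linarith)
          | (rintro rfl; norm_num)
  side_affine u t hu h1 h2 h := by
    refine ⟨?_, 1, 0, by norm_num, .of_forall fun s => by ring⟩
    rw [zigzag_eq_zero] at h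
    rintro (rfl | rfl | rfl | rfl) <;> rcases hu with rfl | rfl <;> norm_num at h

/-- A system of curves that are straight except for a kink at height `-r`, where `r` is `1` or
`-1`. -/
def kinkedPattern (r : ℝ) (hr : r = 1 ∨ r = -1) : SuturePattern where
  η := 1
  δ := r
  -- The slope is `1` below the kink and `-1` above it. At the height of the kink the phase on the
  -- sides is `0` or `2`, not a zero of the triangle wave, so the kink does not disturb
  -- `side_affine`.
  g t := 1 - |t + r|
  η_sq := by norm_num
  δ_sq := by rcases hr with rfl | rfl <;> norm_num
  continuous_g := by fun_prop
  pos_vertex q hq := by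
    rcases hr with rfl | rfl <;>
    rcases mem_posVertices.1 hq with ⟨h, h'⟩ | ⟨h, h'⟩ | ⟨h, h'⟩ | ⟨h, h'⟩ <;>
      rw [h, h'] <;> norm_num [zigzag]
  neg_vertex q hq := by
    rcases hr with rfl | rfl <;>
    rcases mem_negVertices.1 hq with ⟨h, h'⟩ | ⟨h, h'⟩ | ⟨h, h'⟩ | ⟨h, h'⟩ <;>
      rw [h, h'] <;> norm_num [zigzag]
  arc_unique := by
    refine existsUnique_zero_of_isArc (d := fun q => r * q.1 + (1 - |q.2 + r|)) ?_ ?_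
    · intro ε k t hε hk h1 h2
      rw [zigzag_eq_zero]
      rcases hr with rfl | rfl <;> rcases hε with rfl | rfl <;>
        rcases hk with rfl | rfl | rfl <;> constructor
      all_goals
        first
          | (rintro (h | h | h | h) <;> dsimp only at h <;>
              rcases abs_cases (t + 1) with ⟨h3, h4⟩ | ⟨h3, h4⟩ <;> linarith)
          | (rintro (h | h | h | h) <;> dsimp only at h <;>
              rcases abs_cases (t + -1) with ⟨h3, h4⟩ | ⟨h3, h4⟩ <;> linarith)
          | (rintro rfl; norm_num)
    · intro u t ht h1 h2
      rw [zigzag_eq_zero]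
      rcases hr with rfl | rfl <;> rcases ht with rfl | rfl | rfl | rfl <;> norm_num <;>
        try constructor
      all_goals
        first
          | (rintro (h | h | h | h) <;> linarith)
          | (rintro (h | h | h) <;> linarith)
          | (rintro rfl; norm_num)
  side_affine u t hu h1 h2 h := by
    rw [zigzag_eq_zero] at h
    refine ⟨?_, ?_⟩
    · rintro (rfl | rfl | rfl | rfl) <;> rcases hr with rfl | rfl <;> rcases hu with rfl | rfl <;>
        norm_num at h
    · have hne : t + r ≠ 0 := by
        intro h0
        rw [h0] at h
        rcases hr with rfl | rfl <;> rcases hu with rfl | rfl <;> norm_num at h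
      rcases hne.lt_or_gt with h0 | h0
      · refine ⟨1, 1 + r, by norm_num, ?_⟩
        filter_upwards [eventually_lt_nhds (show t < -r by linarith)] with s hs
        rw [abs_of_neg (by linarith)]
        ring
      · refine ⟨-1, 1 - r, by norm_num, ?_⟩
        filter_upwards [eventually_gt_nhds (show -r < t by linarith)] with s hs
        rw [abs_of_pos (by linarith)]
        ring

/-! ### Morphisms of rectangles and morphisms with empty image -/

lemma Slab.edge_eq_or {L : Slab} {E : Set L.surface} (φ : (ℝ × ℝ) ≃ₜ (ℝ × ℝ))
    (hφ : ∀ x : L.rect, x.1 ∈ posVertices ∪ negVertices ↔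
      φ x.1 ∈ posVertices ∪ negVertices) (hE : IsArc (φ '' (Subtype.val '' E)))
    {B : Set (ℝ × ℝ)} (hB : IsArc B) :
    φ '' (Subtype.val '' E) = B ∨ ∀ x ∈ E, φ x.1 ∈ B → x ∈ L.surface.V := by
  refine or_iff_not_imp_right.2 fun h => ?_
  push Not at h
  obtain ⟨x, hxE, hxB, hxV⟩ := h
  exact hE.eq_of_mem hB ⟨x.1, ⟨x, hxE, rfl⟩, rfl⟩ hxB fun h => hxV ((hφ x).2 h)

/-- A homeomorphism of the plane that is planar multiplication by a constant, and maps one slab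
into another respecting vertices and arcs, restricts to a morphism. -/
def slabMorphism {L M : Slab} (φ : (ℝ × ℝ) ≃ₜ (ℝ × ℝ)) (hrect : ∀ p ∈ L.rect, φ p ∈ M.rect)
    (hinside : ∀ p ∈ L.inside, φ p ∈ M.inside)
    (hpos : ∀ p, p ∈ posVertices ↔ φ p ∈ posVertices)
    (hneg : ∀ p, p ∈ negVertices ↔ φ p ∈ negVertices)
    (harc : ∀ E ∈ L.surface.edges, IsArc (φ '' (Subtype.val '' E)))
    (hplanar : ∃ c : ℂ, c ≠ 0 ∧ ∀ p, planar (φ p) = c * planar p) :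
    Morphism L.surface M.surface where
  toFun := ⟨fun x => ⟨φ x.1, hrect x.1 x.2⟩,
    (φ.continuous.comp continuous_subtype_val).subtype_mk _⟩
  interior_embedding := Slab.isOpenEmbedding_restrict
    (f := fun x => ⟨φ x.1, hrect x.1 x.2⟩)
    ((φ.continuous.comp continuous_subtype_val).subtype_mk _) φ fun _ => rfl
  interior_interior x hx := M.notMem_bd.2 (hinside _ (L.notMem_bd.1 hx))
  orientation := by
    rintro e rfl e' rfl x hx -
    obtain ⟨c, hc, h⟩ := hplanar
    refine preservesOrientationAt_of_eventuallyEq hc ?_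
    filter_upwards [L.interiorChart.open_target.mem_nhds (L.interiorChart.map_source hx)] with w hw
    have h1 : planar (L.interiorChart.symm w).1 = w := L.interiorChart.right_inv hw
    change planar (φ (L.interiorChart.symm w).1) = c * w
    rw [h, h1]
  edge_injective E _ x _ y _ h := Subtype.ext (φ.injective (congrArg Subtype.val h))
  edge_edge E hE E' hE' := by
    refine (Slab.edge_eq_or φ (fun x => or_congr (hpos _) (hneg _)) (harc E hE)
      (harc E' hE')).imp (fun h => ?_) fun h x hx y hy hxy => ?_
    · have := Subtype.val_injective.image_injective (φ.injective.image_injective h)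
      rw [this]
    · have hxy' : x = y := Subtype.ext (φ.injective (congrArg Subtype.val hxy))
      subst hxy'
      have := h x hx ⟨x.1, ⟨x, hy, rfl⟩, rfl⟩
      exact ⟨this, this⟩
  edge_target E hE E' hE' := by
    refine (Slab.edge_eq_or φ (fun x => or_congr (hpos _) (hneg _)) (harc E hE)
      (M.mem_edges_iff.1 hE').1).imp (fun h => ?_) fun h x hx hxE' => ?_
    · refine Subtype.val_injective.image_injective ?_
      rw [← h]
      ext q
      constructor
      · rintro ⟨_, ⟨x, hx, rfl⟩, rfl⟩
        exact ⟨_, ⟨x, hx, rfl⟩, rfl⟩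
      · rintro ⟨_, ⟨x, hx, rfl⟩, rfl⟩
        exact ⟨_, ⟨x, hx, rfl⟩, rfl⟩
    · have := h x hx ⟨_, hxE', rfl⟩
      exact ⟨this, this.imp (hpos _).1 (hneg _).1⟩
  sign_source v hv w hw h := by
    have : v = w := Subtype.ext (φ.injective (congrArg Subtype.val h))
    exact Set.disjoint_left.1 disjoint_vertices hv (this ▸ hw)
  sign_pos v hv h := Set.disjoint_left.1 disjoint_vertices ((hpos _).1 hv) h
  sign_neg v hv h := Set.disjoint_left.1 disjoint_vertices h ((hneg _).1 hv)

lemma Morphism.isEmpty_complement {S T : OccupiedSurface} (f : Morphism S T)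
    (hf : Function.Surjective f.toFun) : IsEmpty f.complement := by
  have h : f.complement = ∅ := by
    unfold Morphism.complement
    rw [hf.range_eq, Set.compl_univ, closure_empty]
  exact ⟨fun x => h.subset x.2⟩

/-- A surjective morphism, with its empty decoration. -/
def Morphism.decorate {S T : OccupiedSurface} (f : Morphism S T)
    (hf : Function.Surjective f.toFun) : DecoratedMorphism S T where
  toMorphism := f
  deco :=
    { pos := ∅
      neg := ∅
      isOpen_pos := isOpen_empty
      isOpen_neg := isOpen_empty
      disjoint := Set.disjoint_empty _
      Vpos_subset := fun x => (f.isEmpty_complement hf).elim x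
      Vneg_subset := fun x => (f.isEmpty_complement hf).elim x
      exists_chart := fun x => (f.isEmpty_complement hf).elim x
      edge_unique := fun E hE => by
        -- The complement is empty, so an edge of it would be empty, whereas edges are images of an
        -- interval.
        have hE' : E = ∅ := Set.eq_empty_of_forall_notMem fun x =>
          (f.isEmpty_complement hf).elim x
        subst hE'
        rcases hE with ⟨γ, -, h, -⟩ | ⟨E', ⟨γ, -, h, -⟩, hE'⟩
        · rw [Set.image_empty] at h
          exact absurd h (Set.range_nonempty γ).ne_empty
        · rw [Set.image_empty, ← h] at hE'
          exact absurd hE'.symm ((Set.range_nonempty γ).image _).ne_empty }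

/-- The empty surface. -/
def emptySurface : OccupiedSurface where
  carrier := Empty
  bd := ∅
  exists_chart x := x.elim
  atlas := ∅
  atlas_interior _ he := he.elim
  atlas_cover x := x.elim
  atlas_compatible _ he := he.elim
  Vpos := ∅
  Vneg := ∅
  Vpos_finite := Set.finite_empty
  Vneg_finite := Set.finite_empty
  Vpos_subset := Set.empty_subset _
  Vneg_subset := Set.empty_subset _
  V_disjoint := Set.disjoint_empty _
  component_bd x := x.elim
  edge_cover x := x.elim

instance : IsEmpty emptySurface := inferInstanceAs (IsEmpty Empty)

lemma notMem_edges_emptySurface (E : Set emptySurface) : E ∉ emptySurface.edges := by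
  rintro ⟨γ, -⟩
  exact isEmptyElim (γ 0)

/-- The sutures on the empty surface. -/
def emptySutures : Sutures emptySurface where
  pos := ∅
  neg := ∅
  isOpen_pos := isOpen_empty
  isOpen_neg := isOpen_empty
  disjoint := Set.disjoint_empty _
  Vpos_subset := Set.empty_subset _
  Vneg_subset := Set.empty_subset _
  exists_chart x := isEmptyElim x
  edge_unique E hE := absurd hE (notMem_edges_emptySurface E)

/-- The morphism from the empty surface. -/
def emptyMorphism (S : OccupiedSurface) : Morphism emptySurface S where
  toFun := ⟨fun x => isEmptyElim x, continuous_of_const fun x => isEmptyElim x⟩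
  interior_embedding := by
    have : IsEmpty (emptySurface.bdᶜ : Set emptySurface) := ⟨fun x => isEmptyElim x.1⟩
    exact ⟨.of_subsingleton _, by rw [Set.range_eq_empty]; exact isOpen_empty⟩
  interior_interior x := isEmptyElim x
  orientation _ he := he.elim
  edge_injective E hE := absurd hE (notMem_edges_emptySurface E)
  edge_edge E hE := absurd hE (notMem_edges_emptySurface E)
  edge_target E hE := absurd hE (notMem_edges_emptySurface E)
  sign_source x := isEmptyElim x
  sign_pos x := isEmptyElim x
  sign_neg x := isEmptyElim x

lemma mem_complement_emptyMorphism {S : OccupiedSurface} (x : S) :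
    x ∈ (emptyMorphism S).complement := by
  rw [Morphism.complement, Set.range_eq_empty, Set.compl_empty, closure_univ]
  trivial

/-- Sutures on a surface as a decorated morphism from the empty surface. -/
def Sutures.toDecorated {S : OccupiedSurface} (Γ : Sutures S) :
    DecoratedMorphism emptySurface S where
  toMorphism := emptyMorphism S
  deco :=
    { pos := Subtype.val ⁻¹' Γ.pos
      neg := Subtype.val ⁻¹' Γ.neg
      isOpen_pos := Γ.isOpen_pos.preimage continuous_subtype_val
      isOpen_neg := Γ.isOpen_neg.preimage continuous_subtype_val
      disjoint := Γ.disjoint.preimage _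
      Vpos_subset := by
        rintro y (h | ⟨x, -⟩)
        · exact Γ.Vpos_subset h
        · exact isEmptyElim x
      Vneg_subset := by
        rintro y (h | ⟨x, -⟩)
        · exact Γ.Vneg_subset h
        · exact isEmptyElim x
      exists_chart := by
        intro x hx
        obtain ⟨e, hxe, he⟩ := Γ.exists_chart x.1 hx
        -- The complement of the empty image is all of `S`, but as a subtype; charts are transported
        -- along the tautological homeomorphism.
        let h : (emptyMorphism S).complement ≃ₜ S :=
          { toFun := Subtype.val
            invFun := fun y => ⟨y, mem_complement_emptyMorphism y⟩
            left_inv := fun _ => rfl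
            right_inv := fun _ => rfl
            continuous_toFun := continuous_subtype_val
            continuous_invFun := continuous_id.subtype_mk _ }
        refine ⟨h.toOpenPartialHomeomorph.trans e, by simpa [h] using hxe, fun y hy => ?_⟩
        have hy' : y.1 ∈ e.source := by simpa [h] using hy
        obtain ⟨h1, h2, h3⟩ := he y.1 hy'
        refine ⟨⟨?_, fun h => .inl (h1.2 h)⟩, h2, h3⟩
        rintro (h | ⟨x, -⟩)
        · exact h1.1 h
        · exact isEmptyElim x
      edge_unique := by
        rintro A (hA | ⟨E, hE, -⟩)
        · obtain ⟨x, ⟨⟨y, hyA, rfl⟩, hx⟩, huniq⟩ := Γ.edge_unique _ hA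
          exact ⟨y, ⟨hyA, hx⟩, fun w hw => Subtype.ext (huniq w.1 ⟨⟨w, hw.1, rfl⟩, hw.2⟩)⟩
        · exact absurd hE (notMem_edges_emptySurface E) }

lemma Sutures.decoPos_toDecorated {S : OccupiedSurface} (Γ : Sutures S) :
    Γ.toDecorated.decoPos = Γ.pos :=
  (Set.image_preimage_eq_of_subset fun x _ => ⟨⟨x, mem_complement_emptyMorphism x⟩, rfl⟩)

lemma Sutures.decoNeg_toDecorated {S : OccupiedSurface} (Γ : Sutures S) :
    Γ.toDecorated.decoNeg = Γ.neg :=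
  (Set.image_preimage_eq_of_subset fun x _ => ⟨⟨x, mem_complement_emptyMorphism x⟩, rfl⟩)

lemma Sutures.sends_toDecorated {S : OccupiedSurface} (Γ : Sutures S) :
    Γ.toDecorated.Sends emptySutures Γ := by
  rw [DecoratedMorphism.Sends, decoPos_toDecorated, decoNeg_toDecorated]
  simp [emptySutures]

/-- Decorated morphisms compose with sutures as they act on them. -/
lemma Sutures.isComposite_toDecorated {S T : OccupiedSurface} {f : DecoratedMorphism S T}
    {Γ : Sutures S} {Δ : Sutures T} (h : f.Sends Γ Δ) :
    Γ.toDecorated.IsComposite f Δ.toDecorated := by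
  refine ⟨fun x => isEmptyElim x, ?_, ?_⟩
  · rw [decoPos_toDecorated, decoPos_toDecorated]
    exact h.1
  · rw [decoNeg_toDecorated, decoNeg_toDecorated]
    exact h.2

/-! ### The octagon and its turns -/

/-- The octagon: a disc with eight vertices. -/
def octagon : Slab := ⟨-3, 3, .inl rfl, .inr (.inr (.inr rfl)), by norm_num⟩

/-- The homeomorphisms of the plane that preserve the octagon and the signs of its vertices. -/
structure IsSymmetry (φ : (ℝ × ℝ) ≃ₜ (ℝ × ℝ)) : Prop where
  rect : ∀ p, p ∈ octagon.rect ↔ φ p ∈ octagon.rect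
  inside : ∀ p, p ∈ octagon.inside ↔ φ p ∈ octagon.inside
  pos : ∀ p, p ∈ posVertices ↔ φ p ∈ posVertices
  neg : ∀ p, p ∈ negVertices ↔ φ p ∈ negVertices

lemma IsSymmetry.trans {φ ψ : (ℝ × ℝ) ≃ₜ (ℝ × ℝ)} (hφ : IsSymmetry φ) (hψ : IsSymmetry ψ) :
    IsSymmetry (φ.trans ψ) where
  rect p := (hφ.rect p).trans (hψ.rect _)
  inside p := (hφ.inside p).trans (hψ.inside _)
  pos p := (hφ.pos p).trans (hψ.pos _)
  neg p := (hφ.neg p).trans (hψ.neg _)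

/-- The image of an edge is again a path in the boundary from a negative to a positive vertex with
no vertex between, so `isArc_range` identifies it without tracking individual edges. -/
lemma IsSymmetry.isArc_image {φ : (ℝ × ℝ) ≃ₜ (ℝ × ℝ)} (hφ : IsSymmetry φ)
    {E : Set octagon.surface} (hE : E ∈ octagon.surface.edges) :
    IsArc (φ '' (Subtype.val '' E)) := by
  obtain ⟨γ, -, hr, hbd, h0, h1, hint⟩ := hE
  let γ' : C(unitInterval, ℝ × ℝ) :=
    ⟨fun s => φ (γ s).1, φ.continuous.comp (continuous_subtype_val.comp γ.continuous)⟩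
  have : φ '' (Subtype.val '' E) = Set.range γ' := by
    ext q
    constructor
    · rintro ⟨_, ⟨x, hx, rfl⟩, rfl⟩
      obtain ⟨s, rfl⟩ := hr.superset hx
      exact ⟨s, rfl⟩
    · rintro ⟨s, rfl⟩
      exact ⟨_, ⟨γ s, hr.subset ⟨s, rfl⟩, rfl⟩, rfl⟩
  rw [this]
  refine isArc_range (γ := γ') ((hφ.neg _).1 h0) ((hφ.pos _).1 h1) (fun s hs0 hs1 h => ?_)
    fun s => ?_
  · exact hint s hs0 hs1 (h.imp (hφ.pos _).2 (hφ.neg _).2)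
  · have hs : γ s ∈ octagon.bd := hbd (hr.subset ⟨s, rfl⟩)
    let y : octagon.rect := ⟨φ (γ s).1, (hφ.rect _).1 (γ s).2⟩
    have hy : y ∈ octagon.bd := by
      by_contra h
      exact octagon.notMem_bd.2 ((hφ.inside _).2 (octagon.notMem_bd.1 h)) hs
    obtain ⟨A, hA, hsA, -⟩ := octagon.exists_arc hy
    exact ⟨A, hA, hsA⟩

/-- The rotation by a quarter turn, in rectangular coordinates. -/
def quarterTurn : (ℝ × ℝ) ≃ₜ (ℝ × ℝ) :=
  planar.trans ((Homeomorph.mulLeft₀ Complex.I Complex.I_ne_zero).trans planar.symm)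

lemma planar_quarterTurn (p : ℝ × ℝ) : planar (quarterTurn p) = Complex.I * planar p :=
  planar.apply_symm_apply _

/-- The rotation by a half turn, in rectangular coordinates. -/
def halfTurn : (ℝ × ℝ) ≃ₜ (ℝ × ℝ) := quarterTurn.trans quarterTurn

lemma planar_halfTurn (p : ℝ × ℝ) : planar (halfTurn p) = -1 * planar p := by
  change planar (quarterTurn (quarterTurn p)) = _
  rw [planar_quarterTurn, planar_quarterTurn, ← mul_assoc, Complex.I_mul_I]

/-- `width` is even, so negation in the plane is negation in rectangular coordinates. Only the half
turn is ever applied to sutures; of the quarter turn it matters merely that it is a morphism. -/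
lemma halfTurn_apply (p : ℝ × ℝ) : halfTurn p = -p := by
  apply planar.injective
  rw [planar_halfTurn]
  apply Complex.ext <;> simp [planar, width_neg]

lemma quarterTurn_apply (p : ℝ × ℝ) :
    quarterTurn p = (-p.2 / width (p.1 * width p.2), p.1 * width p.2) := by
  simp [quarterTurn, planar]

lemma isSymmetry_quarterTurn : IsSymmetry quarterTurn := by
  -- The fourth power of the quarter turn is the identity, so invariance in one direction gives the
  -- converse after three more turns.
  have iff_of_imp : ∀ {s : Set (ℝ × ℝ)}, (∀ p ∈ s, quarterTurn p ∈ s) →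
      ∀ p, p ∈ s ↔ quarterTurn p ∈ s := by
    refine fun {s} h p => ⟨h p, fun hp => ?_⟩
    have := h _ (h _ (h _ hp))
    change halfTurn (halfTurn p) ∈ s at this
    rwa [halfTurn_apply, halfTurn_apply, neg_neg] at this
  have hvert : ∀ u t u' t' : ℝ, -t = u' * width t' → u * width t = t' →
      quarterTurn (u, t) = (u', t') := by
    intro u t u' t' h1 h2
    rw [quarterTurn_apply]
    dsimp only
    rw [h2, h1, mul_div_cancel_right₀ _ (width_pos t').ne']
  have w1 : width 1 = 3 := by norm_num [width]
  have w3 : width 3 = 1 := by norm_num [width]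
  refine ⟨iff_of_imp ?_, iff_of_imp ?_, iff_of_imp ?_, iff_of_imp ?_⟩
  · rintro ⟨u, t⟩ ⟨h1, h2, h3, h4⟩
    dsimp only [octagon] at h1 h2 h3 h4
    have hu : |u| ≤ 1 := abs_le.2 ⟨h1, h2⟩
    have ht : |t| ≤ 3 := abs_le.2 ⟨h3, h4⟩
    have hs : |u * width t| ≤ width t := by
      rw [abs_mul, abs_of_pos (width_pos t)]
      exact mul_le_of_le_one_left (width_pos t).le hu
    have hw : width t = min 3 (4 - |t|) := max_eq_right (le_min (by norm_num) (by linarith))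
    rw [hw] at hs
    obtain ⟨hs3, hs4⟩ := le_min_iff.1 hs
    -- With `x = u * width t`, the conditions `|x| ≤ 3`, `|t| ≤ 3`, `|x| + |t| ≤ 4` are symmetric in
    -- `|x|` and `|t|`.
    have hle : |t| ≤ width (u * width t) := by
      rw [hw]
      exact le_max_of_le_right (le_min ht (by linarith))
    rw [quarterTurn_apply]
    have h5 : |-t / width (u * width t)| ≤ 1 := by
      rw [abs_div, abs_neg, abs_of_pos (width_pos _)]
      exact (div_le_one (width_pos _)).2 hle
    rw [← hw] at hs3
    exact ⟨(abs_le.1 h5).1, (abs_le.1 h5).2, (abs_le.1 hs3).1, (abs_le.1 hs3).2⟩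
  · rintro ⟨u, t⟩ ⟨h1, h2, h3, h4⟩
    dsimp only [octagon] at h1 h2 h3 h4
    have hu : |u| < 1 := abs_lt.2 ⟨h1, h2⟩
    have ht : |t| < 3 := abs_lt.2 ⟨h3, h4⟩
    have hs : |u * width t| < width t := by
      rw [abs_mul, abs_of_pos (width_pos t)]
      exact mul_lt_of_lt_one_left (width_pos t) hu
    have hw : width t = min 3 (4 - |t|) := max_eq_right (le_min (by norm_num) (by linarith))
    rw [hw] at hs
    obtain ⟨hs3, hs4⟩ := lt_min_iff.1 hs
    have hlt : |t| < width (u * width t) := by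
      rw [hw]
      exact lt_max_of_lt_right (lt_min ht (by linarith))
    rw [quarterTurn_apply]
    have h5 : |-t / width (u * width t)| < 1 := by
      rw [abs_div, abs_neg, abs_of_pos (width_pos _)]
      exact (div_lt_one (width_pos _)).2 hlt
    rw [← hw] at hs3
    exact ⟨(abs_lt.1 h5).1, (abs_lt.1 h5).2, (abs_lt.1 hs3).1, (abs_lt.1 hs3).2⟩
  · rintro q (rfl | rfl | rfl | rfl)
    · rw [hvert 1 1 (-1) 3 (by rw [w3]; norm_num) (by rw [w1]; norm_num)]
      simp [posVertices]
    · rw [hvert (-1) 3 (-1) (-1) (by rw [width_neg, w1]; norm_num) (by rw [w3]; norm_num)]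
      simp [posVertices]
    · rw [hvert (-1) (-1) 1 (-3) (by rw [width_neg, w3]; norm_num)
        (by rw [width_neg, w1]; norm_num)]
      simp [posVertices]
    · rw [hvert 1 (-3) 1 1 (by rw [w1]; norm_num) (by rw [width_neg, w3]; norm_num)]
      simp [posVertices]
  · rintro q (rfl | rfl | rfl | rfl)
    · rw [hvert (-1) 1 (-1) (-3) (by rw [width_neg, w3]; norm_num)
        (by rw [w1]; norm_num)]
      simp [negVertices]
    · rw [hvert 1 3 (-1) 1 (by rw [w1]; norm_num) (by rw [w3]; norm_num)]
      simp [negVertices]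
    · rw [hvert 1 (-1) 1 3 (by rw [w3]; norm_num) (by rw [width_neg, w1]; norm_num)]
      simp [negVertices]
    · rw [hvert (-1) (-3) 1 (-1) (by rw [width_neg, w1]; norm_num)
        (by rw [width_neg, w3]; norm_num)]
      simp [negVertices]

/-- The decorated automorphism of the octagon given by a symmetry. -/
def IsSymmetry.decorated {φ : (ℝ × ℝ) ≃ₜ (ℝ × ℝ)} (hφ : IsSymmetry φ)
    (h : ∃ c : ℂ, c ≠ 0 ∧ ∀ p, planar (φ p) = c * planar p) :
    DecoratedMorphism octagon.surface octagon.surface :=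
  (slabMorphism (L := octagon) (M := octagon) φ (fun p => (hφ.rect p).1)
    (fun p => (hφ.inside p).1) hφ.pos hφ.neg (fun _ => hφ.isArc_image) h).decorate fun y => by
      have : φ (φ.symm y.1) = y.1 := φ.apply_symm_apply _
      exact ⟨⟨φ.symm y.1, (hφ.rect _).2 (by rw [this]; exact y.2)⟩, Subtype.ext this⟩

lemma IsSymmetry.decoPos_decorated {φ : (ℝ × ℝ) ≃ₜ (ℝ × ℝ)} (hφ : IsSymmetry φ)
    (h : ∃ c : ℂ, c ≠ 0 ∧ ∀ p, planar (φ p) = c * planar p) : (hφ.decorated h).decoPos = ∅ :=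
  Set.image_empty _

lemma IsSymmetry.decoNeg_decorated {φ : (ℝ × ℝ) ≃ₜ (ℝ × ℝ)} (hφ : IsSymmetry φ)
    (h : ∃ c : ℂ, c ≠ 0 ∧ ∀ p, planar (φ p) = c * planar p) : (hφ.decorated h).decoNeg = ∅ :=
  Set.image_empty _

/-- The quarter turn of the octagon. -/
def rotation : DecoratedMorphism octagon.surface octagon.surface :=
  isSymmetry_quarterTurn.decorated ⟨_, Complex.I_ne_zero, planar_quarterTurn⟩

/-- The half turn of the octagon. -/
def rotationSq : DecoratedMorphism octagon.surface octagon.surface :=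
  (isSymmetry_quarterTurn.trans isSymmetry_quarterTurn).decorated
    ⟨-1, by norm_num, planar_halfTurn⟩

/-- Both decorations are empty and the half turn is by definition the quarter turn taken twice.
Through it the action of the half turn becomes a square. -/
lemma isComposite_rotation : rotation.IsComposite rotation rotationSq := by
  refine ⟨fun x => rfl, ?_, ?_⟩
  · simp [rotation, rotationSq, IsSymmetry.decoPos_decorated]
  · simp [rotation, rotationSq, IsSymmetry.decoNeg_decorated]

lemma rotationSq_sends {P P' : SuturePattern} (h : ∀ p, P'.fn (-p) = P.fn p) :
    rotationSq.Sends (P.sutures octagon) (P'.sutures octagon) := by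
  have hval : ∀ x : octagon.surface, (rotationSq.toFun x).1 = -x.1 := fun x => halfTurn_apply x.1
  have h' : ∀ p, P.fn (-p) = P'.fn p := fun p => by rw [← h, neg_neg]
  have hinv : ∀ x : octagon.surface, rotationSq.toFun (rotationSq.toFun x) = x := fun x =>
    Subtype.ext (by rw [hval, hval, neg_neg])
  have hpos : rotationSq.decoPos = ∅ := IsSymmetry.decoPos_decorated _ _
  have hneg : rotationSq.decoNeg = ∅ := IsSymmetry.decoNeg_decorated _ _
  rw [DecoratedMorphism.Sends, hpos, hneg, Set.union_empty, Set.union_empty]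
  constructor
  · ext x
    constructor
    · intro hx
      refine ⟨rotationSq.toFun x, ?_, hinv x⟩
      change 0 < P.fn (rotationSq.toFun x).1
      rw [hval, h']
      exact hx
    · rintro ⟨y, hy, rfl⟩
      change 0 < P'.fn (rotationSq.toFun y).1
      rw [hval, h]
      exact hy
  · ext x
    constructor
    · intro hx
      refine ⟨rotationSq.toFun x, ?_, hinv x⟩
      change P.fn (rotationSq.toFun x).1 < 0
      rw [hval, h']
      exact hx
    · rintro ⟨y, hy, rfl⟩
      change P'.fn (rotationSq.toFun y).1 < 0
      rw [hval, h]
      exact hy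

/-! ### The quadrangulation into three squares -/

/-- The square of height `2` centred at height `m`. -/
def squareAt (m : ℝ) (hm : IsLevel (m - 1)) (hm' : IsLevel (m + 1)) : Slab :=
  ⟨m - 1, m + 1, hm, hm', by linarith⟩

/-- The heights of the centres of the squares into which the octagon is cut. -/
def centre : Fin 3 → ℝ := ![-2, 0, 2]

lemma centre_zero : centre 0 = -2 := rfl

lemma centre_one : centre 1 = 0 := rfl

lemma centre_two : centre 2 = 2 := rfl

/-- The squares into which the octagon is cut. -/
def square (i : Fin 3) : Slab :=
  squareAt (centre i) (by fin_cases i <;> norm_num [centre, IsLevel])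
    (by fin_cases i <;> norm_num [centre, IsLevel])

lemma Slab.image_V (L : Slab) : Subtype.val '' L.surface.V =
    ({1, -1} : Set ℝ) ×ˢ {t | IsLevel t ∧ L.bot ≤ t ∧ t ≤ L.top} := by
  ext q
  constructor
  · rintro ⟨x, hx, rfl⟩
    have := mem_vertices.1 hx
    exact ⟨this.1, this.2, x.2.2.2⟩
  · rintro ⟨h1, h2, h3⟩
    refine ⟨⟨q, ?_, ?_, h3⟩, mem_vertices.2 ⟨h1, h2⟩, rfl⟩
    · rcases h1 with h | h <;> rw [h]; norm_num
    · rcases h1 with h | h <;> rw [h]; norm_num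

lemma Slab.ncard_V (L : Slab) : L.surface.V.ncard =
    2 * {t | IsLevel t ∧ L.bot ≤ t ∧ t ≤ L.top}.ncard := by
  refine (Set.ncard_image_of_injective (α := L.rect) _ Subtype.val_injective).symm.trans ?_
  refine (congrArg Set.ncard L.image_V).trans ?_
  rw [Set.ncard_prod, Set.ncard_pair (by norm_num)]

lemma ncard_V_square (i : Fin 3) : (square i).surface.V.ncard = 4 := by
  have : {t | IsLevel t ∧ (square i).bot ≤ t ∧ t ≤ (square i).top} =
      {(square i).bot, (square i).top} := by
    ext t
    constructor
    · rintro ⟨h1, h2, h3⟩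
      change t = _ ∨ t = _
      revert h2 h3
      fin_cases i <;> rcases h1 with rfl | rfl | rfl | rfl <;>
        norm_num [square, squareAt, centre]
    · rintro (rfl | rfl)
      · exact ⟨(square i).bot_level, le_rfl, (square i).lt.le⟩
      · exact ⟨(square i).top_level, (square i).lt.le, le_rfl⟩
  rw [Slab.ncard_V, this, Set.ncard_pair (square i).lt.ne]

lemma ncard_V_octagon : octagon.surface.V.ncard = 8 := by
  have : {t | IsLevel t ∧ octagon.bot ≤ t ∧ t ≤ octagon.top} = {-3, -1, 1, 3} := by
    ext t
    constructor
    · rintro ⟨h1, -⟩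
      exact h1
    · intro h
      refine ⟨h, ?_⟩
      rcases h with rfl | rfl | rfl | rfl <;> norm_num [octagon]
  rw [Slab.ncard_V, this, Set.ncard_insert_of_notMem (by norm_num),
    Set.ncard_insert_of_notMem (by norm_num), Set.ncard_pair (by norm_num)]

/-- A slab is a disc. -/
lemma Slab.nonempty_homeomorph_disc (L : Slab) :
    Nonempty (L.surface ≃ₜ Metric.closedBall (0 : ℂ) 1) := by
  let l := Complex.equivRealProdCLM.symm
  have hconv : Convex ℝ (l '' L.rect) := by
    rw [L.rect_eq_Icc]
    exact (convex_Icc _ _).linear_image l.toLinearMap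
  have hcomp : IsCompact (l '' L.rect) := by
    rw [L.rect_eq_Icc]
    exact isCompact_Icc.image l.continuous
  have hint : (interior (l '' L.rect)).Nonempty := by
    have hopen : IsOpen (l '' L.inside) := l.toHomeomorph.isOpenMap _ L.isOpen_inside
    have hne : L.inside.Nonempty :=
      ⟨(0, (L.bot + L.top) / 2), by norm_num, by norm_num, by linarith [L.lt], by linarith [L.lt]⟩
    exact (hne.image l).mono (interior_maximal (Set.image_mono L.inside_subset) hopen)
  obtain ⟨h, -, hcl, -⟩ :=
    exists_homeomorph_image_interior_closure_frontier_eq_unitBall hconv hint hcomp.isBounded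
  rw [hcomp.isClosed.closure_eq] at hcl
  exact ⟨(l.toHomeomorph.image L.rect).trans ((h.image _).trans (Homeomorph.setCongr hcl))⟩

lemma square_subset (i : Fin 3) : (square i).rect ⊆ octagon.rect := by
  rintro p ⟨h1, h2, h3, h4⟩
  exact ⟨h1, h2, (square i).bounds.1.trans h3, h4.trans (square i).bounds.2⟩

/-- The inclusion of a square in the octagon. -/
def squareMorphism (i : Fin 3) : Morphism (square i).surface octagon.surface :=
  slabMorphism (Homeomorph.refl _) (square_subset i)
    (fun _ h => ⟨h.1, h.2.1, (square i).bounds.1.trans_lt h.2.2.1,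
      h.2.2.2.trans_le (square i).bounds.2⟩)
    (fun _ => Iff.rfl) (fun _ => Iff.rfl)
    (fun E hE => by
      refine (congrArg IsArc (Set.image_id (Subtype.val '' E))).mpr ?_
      exact ((square i).mem_edges_iff.1 hE).1)
    ⟨1, one_ne_zero, fun p => (one_mul _).symm⟩

lemma image_toFun_squareMorphism (i : Fin 3) (E : Set (square i).surface) :
    Subtype.val '' ((squareMorphism i).toFun '' E) = Subtype.val '' E := by
  ext q
  constructor
  · rintro ⟨_, ⟨x, hx, rfl⟩, rfl⟩
    exact ⟨x, hx, rfl⟩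
  · rintro ⟨x, hx, rfl⟩
    exact ⟨_, ⟨x, hx, rfl⟩, rfl⟩

/-- The octagon, cut into three squares. -/
abbrev quadrangulation : Quadrangulation octagon.surface where
  ι := Fin 3
  square i := (square i).surface
  isSquare i := ⟨(square i).nonempty_homeomorph_disc, ncard_V_square i⟩
  map := squareMorphism
  vertex _ _ hv := hv
  interior_disjoint i j hij x hx y hy h := by
    have hxy : x.1 = y.1 := congrArg Subtype.val h
    obtain ⟨-, -, h1, h2⟩ := (square i).notMem_bd.1 hx
    obtain ⟨-, -, h3, h4⟩ := (square j).notMem_bd.1 hy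
    rw [hxy] at h1 h2
    fin_cases i <;> fin_cases j <;> first
      | exact hij rfl
      | (norm_num [square, squareAt, centre] at h1 h2 h3 h4; linarith)
  edge_edge i j E hE E' hE' := by
    have hA := ((square i).mem_edges_iff.1 hE).1
    have hA' := ((square j).mem_edges_iff.1 hE').1
    refine or_iff_not_imp_right.2 fun h => ?_
    push Not at h
    obtain ⟨x, hx, y, hy, hxy, hV⟩ := h
    have hxy' : x.1 = y.1 := congrArg Subtype.val hxy
    refine Subtype.val_injective.image_injective ?_
    refine (image_toFun_squareMorphism i E).trans
      (Eq.trans ?_ (image_toFun_squareMorphism j E').symm)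
    refine hA.eq_of_mem hA' ⟨x, hx, rfl⟩ ⟨y, hy, hxy'.symm⟩ fun hx' => ?_
    exact hV hx' (by
      rw [hxy'] at hx'
      exact hx')
  cover x := by
    left
    obtain ⟨⟨u, t⟩, h1, h2, h3, h4⟩ := x
    dsimp only [octagon] at h1 h2 h3 h4
    have key : ∀ i, (u, t) ∈ (square i).rect →
        ∃ i, (⟨(u, t), h1, h2, h3, h4⟩ : octagon.rect) ∈ Set.range (squareMorphism i).toFun :=
      fun i h => ⟨i, ⟨(u, t), h⟩, rfl⟩
    rcases le_total t (-1) with h | h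
    · exact key 0 ⟨h1, h2, by norm_num [square, squareAt, centre_zero, centre_one, centre_two]; linarith,
        by norm_num [square, squareAt, centre_zero, centre_one, centre_two]; linarith⟩
    rcases le_total t 1 with h' | h'
    · exact key 1 ⟨h1, h2, by norm_num [square, squareAt, centre_zero, centre_one, centre_two]; linarith,
        by norm_num [square, squareAt, centre_zero, centre_one, centre_two]; linarith⟩
    · exact key 2 ⟨h1, h2, by norm_num [square, squareAt, centre_zero, centre_one, centre_two]; linarith,
        by norm_num [square, squareAt, centre_zero, centre_one, centre_two]; linarith⟩

lemma not_inVacuum_octagon (x : octagon.surface) : ¬ octagon.surface.InVacuum x := by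
  rintro ⟨-, h⟩
  have : connectedComponent x = Set.univ :=
    PreconnectedSpace.connectedComponent_eq_univ (X := octagon.rect) x
  rw [this, Set.univ_inter, ncard_V_octagon] at h
  norm_num at h

/-- The identification of a square with the model square, reflected if `s = -1`. -/
def toModel (i : Fin 3) (s : ℝ) (hs : s = 1 ∨ s = -1) : (square i).surface ≃ₜ ModelSquare where
  toFun x := ⟨(s * x.1.1, x.1.2 - centre i), by
    obtain ⟨h1, h2, h3, h4⟩ := x.2
    dsimp only [square, squareAt] at h3 h4
    rw [abs_le, abs_le]
    rcases hs with rfl | rfl <;>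
      exact ⟨⟨by linarith, by linarith⟩, ⟨by linarith, by linarith⟩⟩⟩
  invFun y := ⟨(s * y.1.1, y.1.2 + centre i), by
    obtain ⟨h1, h2⟩ := y.2
    rw [abs_le] at h1 h2
    rcases hs with rfl | rfl <;>
      exact ⟨by linarith, by linarith, by dsimp only [square, squareAt]; linarith,
        by dsimp only [square, squareAt]; linarith⟩⟩
  left_inv x := Subtype.ext (Prod.ext (by rcases hs with rfl | rfl <;> simp) (by simp))
  right_inv x := Subtype.ext (Prod.ext (by rcases hs with rfl | rfl <;> simp) (by simp))
  continuous_toFun := by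
    have : Continuous fun x : (square i).surface => x.1 := continuous_subtype_val
    exact Continuous.subtype_mk (by fun_prop) _
  continuous_invFun := by
    have : Continuous fun x : ModelSquare => x.1 := continuous_subtype_val
    exact Continuous.subtype_mk (by fun_prop) _

/-- The positive vertices lie on one diagonal of the middle square and on the other diagonal of the
outer two, hence the optional reflection `s`. -/
lemma isBasicPos_sutures {P : SuturePattern} {i : Fin 3} (s : ℝ) (hs : s = 1 ∨ s = -1)
    (h : ∀ p ∈ (square i).rect, P.fn p = |s * p.1 + (p.2 - centre i)| - 1) :
    IsBasicPos (P.sutures (square i)) := by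
  refine ⟨toModel i s hs, Set.ext fun x => ?_, Set.ext fun x => ?_⟩
  · change 0 < P.fn x.1 ↔ 1 < |s * x.1.1 + (x.1.2 - centre i)|
    rw [h _ x.2, sub_pos]
  · change P.fn x.1 < 0 ↔ |s * x.1.1 + (x.1.2 - centre i)| < 1
    rw [h _ x.2, sub_neg]

lemma isBasicNeg_sutures {P : SuturePattern} {i : Fin 3} (s : ℝ) (hs : s = 1 ∨ s = -1)
    (h : ∀ p ∈ (square i).rect, P.fn p = 1 - |s * p.1 - (p.2 - centre i)|) :
    IsBasicNeg (P.sutures (square i)) := by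
  refine ⟨toModel i s hs, Set.ext fun x => ?_, Set.ext fun x => ?_⟩
  · change P.fn x.1 < 0 ↔ 1 < |s * x.1.1 - (x.1.2 - centre i)|
    rw [h _ x.2, sub_neg]
  · change 0 < P.fn x.1 ↔ |s * x.1.1 - (x.1.2 - centre i)| < 1
    rw [h _ x.2, sub_pos]

/-- The same function cuts out the regions on the octagon and on the squares, so restrictions agree
definitionally; with eight vertices on a connected surface there is no vacuum. -/
lemma isBasic_sutures (P : SuturePattern)
    (h : ∀ i, IsBasicPos (P.sutures (square i)) ∨ IsBasicNeg (P.sutures (square i))) :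
    quadrangulation.IsBasic (P.sutures octagon) fun i => P.sutures (square i) :=
  ⟨fun i => ⟨rfl, rfl, h i⟩, fun x hx => absurd hx (not_inVacuum_octagon x)⟩

/-! ### The three basic sets of sutures of degree -1 -/

/-- Three patterns of sutures: a half turn fixes the first and exchanges the other two. -/
def pattern : Fin 3 → SuturePattern :=
  ![straightPattern, kinkedPattern 1 (.inl rfl), kinkedPattern (-1) (.inr rfl)]

lemma fn_pattern_zero (p : ℝ × ℝ) : (pattern 0).fn p = -zigzag (p.1 + p.2) := by
  simp [SuturePattern.fn, pattern, straightPattern]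

lemma fn_pattern_one (p : ℝ × ℝ) : (pattern 1).fn p = zigzag (p.1 + (1 - |p.2 + 1|)) := by
  simp [SuturePattern.fn, pattern, kinkedPattern]

lemma fn_pattern_two (p : ℝ × ℝ) : (pattern 2).fn p = zigzag (-p.1 + (1 - |p.2 - 1|)) := by
  simp [SuturePattern.fn, pattern, kinkedPattern, sub_eq_add_neg]

/-- The squares on which the patterns restrict to positive basic sutures. -/
def positiveSquare : Fin 3 → Fin 3 := ![1, 2, 0]

lemma zigzag_of_nonneg {d : ℝ} (h : 0 ≤ d) : zigzag d = |d - 2| - 1 := by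
  rw [zigzag, abs_of_nonneg h]

lemma zigzag_of_nonpos {d : ℝ} (h : d ≤ 0) : zigzag d = |d + 2| - 1 := by
  rw [zigzag, abs_of_nonpos h, ← abs_neg]
  ring_nf

lemma zigzag_of_abs_le {d : ℝ} (h : -2 ≤ d) (h' : d ≤ 2) : zigzag d = 1 - |d| := by
  rw [zigzag, abs_of_nonpos (by linarith [abs_le.2 ⟨h, h'⟩])]
  ring

/-- On a single square the phase stays in a range where the triangle wave has only one peak or
trough, so it simplifies to one absolute value, centred at the centre of the square. -/
lemma isBasicPos_pattern (j : Fin 3) :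
    IsBasicPos ((pattern j).sutures (square (positiveSquare j))) := by
  fin_cases j
  · change IsBasicPos ((pattern 0).sutures (square 1))
    refine isBasicPos_sutures 1 (.inl rfl) ?_
    rintro ⟨u, t⟩ ⟨h1, h2, h3, h4⟩
    norm_num [square, squareAt, centre_zero, centre_one, centre_two] at h1 h2 h3 h4
    norm_num [fn_pattern_zero, fn_pattern_one, fn_pattern_two, centre_zero, centre_one, centre_two]
    rw [zigzag_of_abs_le (by linarith) (by linarith)]
    ring
  · change IsBasicPos ((pattern 1).sutures (square 2))
    refine isBasicPos_sutures (-1) (.inr rfl) ?_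
    rintro ⟨u, t⟩ ⟨h1, h2, h3, h4⟩
    norm_num [square, squareAt, centre_zero, centre_one, centre_two] at h1 h2 h3 h4
    norm_num [fn_pattern_zero, fn_pattern_one, fn_pattern_two, centre_zero, centre_one, centre_two]
    rw [abs_of_nonneg (by linarith), zigzag_of_nonpos (by linarith), ← abs_neg]
    ring_nf
  · change IsBasicPos ((pattern 2).sutures (square 0))
    refine isBasicPos_sutures (-1) (.inr rfl) ?_
    rintro ⟨u, t⟩ ⟨h1, h2, h3, h4⟩
    norm_num [square, squareAt, centre_zero, centre_one, centre_two] at h1 h2 h3 h4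
    norm_num [fn_pattern_zero, fn_pattern_one, fn_pattern_two, centre_zero, centre_one, centre_two]
    rw [abs_of_nonpos (by linarith), zigzag_of_nonpos (by linarith)]
    ring_nf

lemma isBasicNeg_pattern {j i : Fin 3} (hij : i ≠ positiveSquare j) :
    IsBasicNeg ((pattern j).sutures (square i)) := by
  fin_cases j <;> fin_cases i <;> first | exact absurd rfl hij | skip
  · change IsBasicNeg ((pattern 0).sutures (square 0))
    refine isBasicNeg_sutures (-1) (.inr rfl) ?_
    rintro ⟨u, t⟩ ⟨h1, h2, h3, h4⟩
    norm_num [square, squareAt, centre_zero, centre_one, centre_two] at h1 h2 h3 h4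
    norm_num [fn_pattern_zero, fn_pattern_one, fn_pattern_two, centre_zero, centre_one, centre_two]
    rw [zigzag_of_nonpos (by linarith), ← abs_neg]
    ring_nf
  · change IsBasicNeg ((pattern 0).sutures (square 2))
    refine isBasicNeg_sutures (-1) (.inr rfl) ?_
    rintro ⟨u, t⟩ ⟨h1, h2, h3, h4⟩
    norm_num [square, squareAt, centre_zero, centre_one, centre_two] at h1 h2 h3 h4
    norm_num [fn_pattern_zero, fn_pattern_one, fn_pattern_two, centre_zero, centre_one, centre_two]
    rw [zigzag_of_nonneg (by linarith), ← abs_neg]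
    ring_nf
  · change IsBasicNeg ((pattern 1).sutures (square 0))
    refine isBasicNeg_sutures (-1) (.inr rfl) ?_
    rintro ⟨u, t⟩ ⟨h1, h2, h3, h4⟩
    norm_num [square, squareAt, centre_zero, centre_one, centre_two] at h1 h2 h3 h4
    norm_num [fn_pattern_zero, fn_pattern_one, fn_pattern_two, centre_zero, centre_one, centre_two]
    rw [abs_of_nonpos (by linarith), zigzag_of_abs_le (by linarith) (by linarith), ← abs_neg]
    ring_nf
  · change IsBasicNeg ((pattern 1).sutures (square 1))
    refine isBasicNeg_sutures 1 (.inl rfl) ?_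
    rintro ⟨u, t⟩ ⟨h1, h2, h3, h4⟩
    norm_num [square, squareAt, centre_zero, centre_one, centre_two] at h1 h2 h3 h4
    norm_num [fn_pattern_zero, fn_pattern_one, fn_pattern_two, centre_zero, centre_one, centre_two]
    rw [abs_of_nonneg (by linarith), zigzag_of_abs_le (by linarith) (by linarith)]
    ring_nf
  · change IsBasicNeg ((pattern 2).sutures (square 1))
    refine isBasicNeg_sutures 1 (.inl rfl) ?_
    rintro ⟨u, t⟩ ⟨h1, h2, h3, h4⟩
    norm_num [square, squareAt, centre_zero, centre_one, centre_two] at h1 h2 h3 h4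
    norm_num [fn_pattern_zero, fn_pattern_one, fn_pattern_two, centre_zero, centre_one, centre_two]
    rw [abs_of_nonpos (by linarith), zigzag_of_abs_le (by linarith) (by linarith), ← abs_neg]
    ring_nf
  · change IsBasicNeg ((pattern 2).sutures (square 2))
    refine isBasicNeg_sutures (-1) (.inr rfl) ?_
    rintro ⟨u, t⟩ ⟨h1, h2, h3, h4⟩
    norm_num [square, squareAt, centre_zero, centre_one, centre_two] at h1 h2 h3 h4
    norm_num [fn_pattern_zero, fn_pattern_one, fn_pattern_two, centre_zero, centre_one, centre_two]
    rw [abs_of_nonneg (by linarith), zigzag_of_abs_le (by linarith) (by linarith)]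
    ring_nf

lemma isBasic_pattern (j : Fin 3) :
    quadrangulation.IsBasic ((pattern j).sutures octagon)
      fun i => (pattern j).sutures (square i) :=
  isBasic_sutures _ fun i => by
    by_cases h : i = positiveSquare j
    · exact .inl (h ▸ isBasicPos_pattern j)
    · exact .inr (isBasicNeg_pattern h)

lemma zigzag_neg (d : ℝ) : zigzag (-d) = zigzag d := by simp [zigzag]

/-- The triangle wave is even, which settles the straight pattern; negation exchanges the kinks at
heights `1` and `-1`, and with them the other two. -/
lemma rotationSq_sends_pattern {j j' : Fin 3}
    (h : j = 0 ∧ j' = 0 ∨ j = 1 ∧ j' = 2 ∨ j = 2 ∧ j' = 1) :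
    rotationSq.Sends ((pattern j).sutures octagon) ((pattern j').sutures octagon) := by
  refine rotationSq_sends fun p => ?_
  rcases h with ⟨rfl, rfl⟩ | ⟨rfl, rfl⟩ | ⟨rfl, rfl⟩ <;>
    simp only [fn_pattern_zero, fn_pattern_one, fn_pattern_two, Prod.fst_neg, Prod.snd_neg]
  · rw [← zigzag_neg]
    ring_nf
  · rw [← abs_neg (p.2 + 1)]
    ring_nf
  · rw [← abs_neg (p.2 - 1)]
    ring_nf

/-! ### Basis vectors of degree -1 and the contradiction -/

/-- The types of basic sutures, `0` for negative and `1` for positive, to which the patterns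
restrict on the squares. -/
def patternType (j i : Fin 3) : Fin 2 := if i = positiveSquare j then 1 else 0

lemma patternType_injective : Function.Injective patternType := by decide

/-- Three signs add up to -1 exactly when one of them is positive. Hence the patterns account for
the whole basis in degree -1, as the determinant argument needs. -/
lemma sum_eq_neg_one_iff (k : Fin 3 → Fin 2) :
    ∑ i, (![-1, 1] : Fin 2 → ℤ) (k i) = -1 ↔ k ∈ Set.range patternType := by
  revert k
  simp only [Set.mem_range]
  decide

/-- Signs can be moved out of a tensor product. -/
lemma exists_unit_smul_tprod {ι A : Type*} [Fintype ι] [CommRing A] {M : ι → Type*}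
    [∀ i, AddCommGroup (M i)] {x v : ∀ i, M i} (h : ∀ i, x i = v i ∨ x i = -v i) (r : Aˣ) :
    ∃ w : Aˣ, r.val ⊗ₜ[ℤ] PiTensorProduct.tprod ℤ x =
      w.val • ((1 : A) ⊗ₜ[ℤ] PiTensorProduct.tprod ℤ v) := by
  have hs : ∀ i, ∃ s : ℤˣ, x i = s.val • v i := fun i => (h i).elim
    (fun h => ⟨1, by simp [h]⟩) fun h => ⟨-1, by simp [h]⟩
  choose s hs using hs
  refine ⟨Units.map (Int.castRingHom A).toMonoidHom (∏ i, s i) * r, ?_⟩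
  rw [show x = fun i => (s i).val • v i from funext hs, MultilinearMap.map_smul_univ,
    TensorProduct.tmul_smul, TensorProduct.smul_tmul', TensorProduct.smul_tmul']
  simp [Units.coe_prod]

/-- There are no suture elements on the octagon, not even up to units, on which a half turn acts
exactly as it does on sutures. -/
lemma TwistedFunctor.false_of_suture_elements (𝓕 : TwistedFunctor.{u})
    (e : 𝓕.V octagon.surface ≃ₗ[GroupRing octagon.surface] 𝓕.Tensor quadrangulation)
    (he : 𝓕.IsGradedIso quadrangulation e) (zero one : ∀ i, 𝓕.V (quadrangulation.square i))
    (hli : ∀ i, LinearIndependent ℤ ![zero i, one i])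
    (hspan : ∀ i, Submodule.span ℤ {zero i, one i} = ⊤)
    (hzero : ∀ i, zero i ∈ 𝓕.gr (quadrangulation.square i) (-1))
    (hone : ∀ i, one i ∈ 𝓕.gr (quadrangulation.square i) 1) (a : Fin 3 → 𝓕.V octagon.surface)
    (ha : ∀ j, ∃ (r : (GroupRing octagon.surface)ˣ) (x : ∀ i, 𝓕.V (quadrangulation.square i)),
      (∀ i, x i = ![zero i, one i] (patternType j i) ∨
        x i = -![zero i, one i] (patternType j i)) ∧
      e (a j) = r.val ⊗ₜ[ℤ] PiTensorProduct.tprod ℤ x)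
    (hD : ∀ j j', (j = 0 ∧ j' = 0 ∨ j = 1 ∧ j' = 2 ∨ j = 2 ∧ j' = 1) →
      𝓕.D rotationSq (a j) = a j') : False := by
  obtain ⟨b, hb, hbdeg⟩ : ∃ b : Module.Basis (Fin 3 → Fin 2) (GroupRing octagon.surface)
      (𝓕.V octagon.surface),
      (∀ k, e (b k) = 1 ⊗ₜ[ℤ] PiTensorProduct.tprod ℤ fun i => ![zero i, one i] (k i)) ∧
      ∀ k, b k ∈ 𝓕.gr octagon.surface (∑ i, ![-1, 1] (k i)) :=
    𝓕.exists_basis quadrangulation e he zero one hli hspan hzero hone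
  obtain ⟨d, hd⟩ := 𝓕.D_graded rotation
  have hw : ∀ j, ∃ w : (GroupRing octagon.surface)ˣ, a j = w.val • b (patternType j) := by
    intro j
    obtain ⟨r, x, hx, hax⟩ := ha j
    obtain ⟨w, hw⟩ := exists_unit_smul_tprod hx r
    refine ⟨w, e.injective ?_⟩
    rw [hax, hw, map_smul]
    exact congrArg _ (hb _).symm
  choose w hw using hw
  -- Here functoriality enters without any ambiguity of units.
  have hsq : ∀ v, 𝓕.D rotation (𝓕.D rotation v) = 𝓕.D rotationSq v := fun v => by
    rw [𝓕.D_composite _ _ _ isComposite_rotation]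
    rfl
  refine false_of_sq_swap (𝓕.gr_internal _) b hbdeg (GroupRing.aug _)
    (GroupRing.map rotation.toFun) (GroupRing.aug_map _) (𝓕.D rotation) (𝓕.D_smul rotation) hd
    patternType patternType_injective (fun k => sum_eq_neg_one_iff k) a w hw ?_ ?_ ?_
  · rw [hsq, hD 0 0 (by simp)]
  · rw [hsq, hD 1 2 (by simp)]
  · rw [hsq, hD 2 1 (by simp)]

/-- The suture elements of the three patterns are themselves permuted by the half turn, by
`respects`. -/
lemma isEmpty_optimisticTSQFT : IsEmpty OptimisticTSQFT.{u} := by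
  refine ⟨fun 𝓕 => ?_⟩
  obtain ⟨e, he, hbasic⟩ := 𝓕.tensor quadrangulation
  choose zero one hone' hzero' hli hspan hzero hone using
    fun i => 𝓕.basis (quadrangulation.square i) (quadrangulation.isSquare i)
  refine 𝓕.false_of_suture_elements e he zero one hli hspan hzero hone
    (fun j => 𝓕.c ((pattern j).sutures octagon)) (fun j => ⟨1, _, fun i => .inl ?_,
      hbasic _ _ (isBasic_pattern j)⟩) fun j j' h => 𝓕.respects _ _ _ (rotationSq_sends_pattern h)
  by_cases h : i = positiveSquare j
  · rw [show patternType j i = 1 from if_pos h]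
    exact hone' i _ (h ▸ isBasicPos_pattern j)
  · rw [show patternType j i = 0 from if_neg h]
    exact hzero' i _ (isBasicNeg_pattern h)

/-- Applied to the half turn, `respects` would leave an undetermined unit, which could absorb the
sign. Pushing one element `v` of `c(∅)` along the sutures, seen as morphisms, chooses
representatives coherently: `respects` places them in the right orbits, and functoriality makes the
half turn permute them exactly. -/
lemma isEmpty_sanguineTSQFT : IsEmpty SanguineTSQFT.{u} := by
  refine ⟨fun 𝓕 => ?_⟩
  obtain ⟨e, he, hbasic⟩ := 𝓕.tensor quadrangulation
  choose zero one hone' hzero' hli hspan hzero hone using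
    fun i => 𝓕.basis (quadrangulation.square i) (quadrangulation.isSquare i)
  obtain ⟨v, hv⟩ : (𝓕.c emptySutures).Nonempty := by
    obtain ⟨x, hx⟩ := 𝓕.c_orbit emptySutures
    exact hx ▸ ⟨x, 1, by simp⟩
  refine 𝓕.false_of_suture_elements e he zero one hli hspan hzero hone
    (fun j => 𝓕.D ((pattern j).sutures octagon).toDecorated v) (fun j => ?_) fun j j' h => ?_
  · have hmem := 𝓕.respects _ _ _ (Sutures.sends_toDecorated ((pattern j).sutures octagon))
      (Set.mem_image_of_mem _ hv)
    obtain ⟨r, x, hx, hex⟩ := (hbasic _ _ (isBasic_pattern j)).subset (Set.mem_image_of_mem e hmem)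
    refine ⟨r, x, fun i => ?_, hex⟩
    have hxi := hx i
    by_cases h : i = positiveSquare j
    · rw [show patternType j i = 1 from if_pos h]
      exact (hone' i _ (h ▸ isBasicPos_pattern j)).subset hxi
    · rw [show patternType j i = 0 from if_neg h]
      exact (hzero' i _ (isBasicNeg_pattern h)).subset hxi
  · exact (DFunLike.congr_fun (𝓕.D_composite _ _ _
      (Sutures.isComposite_toDecorated (rotationSq_sends_pattern h))) v).symm

end TSQFT

theorem mainTheorem2 :
    IsEmpty TSQFT.OptimisticTSQFT.{u} ∧ IsEmpty TSQFT.SanguineTSQFT.{u} :=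
  ⟨TSQFT.isEmpty_optimisticTSQFT, TSQFT.isEmpty_sanguineTSQFT⟩

end
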